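/- **Setting.** Let $\Gamma:\mathbb R\to\mathbb R^2$ be a $C^2$ curve without self-intersections, parametrized by arc length, with signed curvature $\gamma=\dot\Gamma_2\ddot\Gamma_1-\dot\Gamma_1\ddot\Gamma_2$, and let $a>0$. Assume: - either $\gamma$ has compact support, or $\Gamma$ is $C^4$ and $\gamma(s),\dot\gamma(s),\ddot\gamma(s)\to0$ as $|s|\to\infty$; - $|\Gamma(s)-\Gamma(s')|\to\infty$ as $|s-s'|\to\infty$; - $a\|\gamma\|_\infty<1$, and the points of the strip $\Omega^a=\{x\in\mathbb R^2:\operatorname{dist}(x,\Gamma)<a\}$ are uniquely parametrized by the strip coordinates, i.e. the map $x(s,u)=(\Gamma_1(s)-u\dot\Gamma_2(s),\ \Gamma_2(s)+u\dot\Gamma_1(s))$ is injective on $\mathbb R\times(-a,a)$. Let $V\in L^\infty(\mathbb R)$ be nonzero, $V\ge0$, $\operatorname{supp}V\subset[-a,a]$. Define $\tilde V(x(s,u))=V(u)$ on $\Omega^a$ and $\tilde V=0$ outside $\Omega^a$, and let $H_{\Gamma,V}=-\Delta-\tilde V$ in $L^2(\mathbb R^2)$ with domain $H^2(\mathbb R^2)$.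 For $z\in\mathbb C\setminus[0,\infty)$ let $$K_{\Gamma,V}(z)=\tilde V^{1/2}(-\Delta-z)^{-1}\tilde V^{1/2},$$ regarded as a bounded operator on $L^2(\Omega^a)$. The discrete spectrum $\sigma_{\rm disc}(A)$ is the set of isolated points of the spectrum of $A$ that are eigenvalues of finite algebraic multiplicity (the dimension of the space of root vectors, which for self-adjoint $A$ is the eigenspace). **Proposition.** 1. For every $z\in\mathbb C\setminus[0,\infty)$: $z\in\sigma_{\rm disc}(H_{\Gamma,V})$ if and only if $1\in\sigma_{\rm disc}(K_{\Gamma,V}(z))$. 2. The function $\kappa\mapsto K_{\Gamma,V}(-\kappa^2)$ is continuous on $(0,\infty)$ in the operator norm. 3. It is strictly decreasing on $(0,\infty)$ in the order of self-adjoint operators: for $0<\kappa_1<\kappa_2$ the operator $K_{\Gamma,V}(-\kappa_1^2)-K_{\Gamma,V}(-\kappa_2^2)$ is positive and nonzero. Moreover, for every $\psi\in L^2(\Omega^a)$ with $\tilde V^{1/2}\psi\neq0$ the function $\kappa\mapsto(\psi,K_{\Gamma,V}(-\kappa^2)\psi)$ is strictly decreasing on $(0,\infty)$. 4. $\|K_{\Gamma,V}(-\kappa^2)\|\le\kappa^{-2}\|V\|_\infty$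 for all $\kappa>0$; in particular $\|K_{\Gamma,V}(-\kappa^2)\|\to0$ as $\kappa\to\infty$. -/

import Mathlib

open MeasureTheory Filter Topology
open scoped ENNReal SchwartzMap Laplacian

namespace SoftWaveguide

noncomputable section

/-! ### Resolvent and discrete spectrum of a (possibly unbounded) operator -/

section Spectral

variable {X : Type*} [NormedAddCommGroup X] [NormedSpace ℂ X]

/-- `R` is a bounded everywhere defined two-sided inverse of `A - z : D(A) → X`. -/
def IsResolventAt (A : X →ₗ.[ℂ] X) (z : ℂ) (R : X →L[ℂ] X) : Prop :=
  (∀ y : X, ∃ h : R y ∈ A.domain, A ⟨R y, h⟩ - z • R y = y) ∧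
    ∀ x : A.domain, R (A x - z • (x : X)) = x

/-- The resolvent set of `A`; the spectrum is its complement. -/
def resolventSet (A : X →ₗ.[ℂ] X) : Set ℂ := {z | ∃ R : X →L[ℂ] X, IsResolventAt A z R}

open Classical in
/-- The resolvent `(A - z)⁻¹` (only meaningful for `z` in the resolvent set). -/
def resolvent (A : X →ₗ.[ℂ] X) (z : ℂ) : X →L[ℂ] X :=
  if h : ∃ R : X →L[ℂ] X, IsResolventAt A z R then h.choose else 0

/-- `ker (A - z) ^ n`, where `x ∈ ker (A - z) ^ (n + 1)` means that `x ∈ D(A)` and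
`(A - z) x ∈ ker (A - z) ^ n`. -/
def rootSpace (A : X →ₗ.[ℂ] X) (z : ℂ) : ℕ → Submodule ℂ X
  | 0 => ⊥
  | n + 1 => ((rootSpace A z n).comap (A.toFun - z • A.domain.subtype)).map A.domain.subtype

/-- The discrete spectrum: the isolated points of the spectrum that are eigenvalues of finite
algebraic multiplicity (the algebraic multiplicity is the dimension of the space of all root
vectors; for a self-adjoint operator it is the dimension of the eigenspace). -/
def discreteSpectrum (A : X →ₗ.[ℂ] X) : Set ℂ :=
  {z | (∀ᶠ w in 𝓝[≠] z, w ∈ resolventSet A) ∧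
    (∃ x : A.domain, (x : X) ≠ 0 ∧ A x = z • (x : X)) ∧
    FiniteDimensional ℂ (⨆ n, rootSpace A z n : Submodule ℂ X)}

/-- A bounded operator, regarded as an operator with domain the whole space. -/
def ofBounded (T : X →L[ℂ] X) : X →ₗ.[ℂ] X := (T : X →ₗ[ℂ] X).toPMap ⊤

end Spectral

/-! ### The Laplacian and multiplication operators on `L²(ℝ²)` -/

/-- The Euclidean plane. -/
abbrev Plane : Type := EuclideanSpace ℝ (Fin 2)

/-- The complex Hilbert space `L²(ℝ²)`. -/
abbrev L2Plane : Type := Lp ℂ 2 (volume : Measure Plane)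

/-- The Sobolev space `H²(ℝ²)` as a subspace of `L²(ℝ²)`. -/
def sobolevH2 : Submodule ℂ L2Plane where
  carrier := {f | TemperedDistribution.MemSobolev 2 2 (f : 𝓢'(Plane, ℂ))}
  add_mem' {f g} hf hg := by
    have := TemperedDistribution.MemSobolev.add hf hg
    simpa only [Set.mem_ofPred_eq, ← Lp.toTemperedDistributionCLM_apply, map_add] using this
  zero_mem' := by
    simp only [Set.mem_ofPred_eq, ← Lp.toTemperedDistributionCLM_apply, map_zero]
    exact TemperedDistribution.memSobolev_fun_zero _ _ _ _
  smul_mem' c f hf := by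
    have := TemperedDistribution.MemSobolev.smul c hf
    simpa only [Set.mem_ofPred_eq, ← Lp.toTemperedDistributionCLM_apply, map_smul] using this

theorem toTemperedDistribution_injective {f g : L2Plane}
    (h : (f : 𝓢'(Plane, ℂ)) = (g : 𝓢'(Plane, ℂ))) : f = g := by
  have hk := Lp.ker_toTemperedDistributionCLM_eq_bot (E := Plane) (F := ℂ)
    (μ := (volume : Measure Plane)) (p := 2)
  exact LinearMap.ker_eq_bot.mp hk h

theorem exists_laplacian (f : sobolevH2) :
    ∃ g : L2Plane, (g : 𝓢'(Plane, ℂ)) = Δ ((f : L2Plane) : 𝓢'(Plane, ℂ)) := by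
  have h : TemperedDistribution.MemSobolev 2 2 ((f : L2Plane) : 𝓢'(Plane, ℂ)) := f.2
  have h0 := h.laplacian
  rw [sub_self] at h0
  obtain ⟨g, hg⟩ := TemperedDistribution.memSobolev_zero_iff.mp h0
  exact ⟨g, hg.symm⟩

/-- The distributional Laplacian of an `H²` function, as an `L²` function. -/
def laplacianL2 (f : sobolevH2) : L2Plane := (exists_laplacian f).choose

theorem laplacianL2_spec (f : sobolevH2) :
    (laplacianL2 f : 𝓢'(Plane, ℂ)) = Δ ((f : L2Plane) : 𝓢'(Plane, ℂ)) :=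
  (exists_laplacian f).choose_spec

/-- The operator `-Δ` in `L²(ℝ²)` with domain `H²(ℝ²)`. -/
def negLaplacian : L2Plane →ₗ.[ℂ] L2Plane where
  domain := sobolevH2
  toFun :=
    { toFun := fun f => -laplacianL2 f
      map_add' := fun f g => by
        rw [← neg_add]
        congr 1
        apply toTemperedDistribution_injective
        rw [laplacianL2_spec]
        simp only [← Lp.toTemperedDistributionCLM_apply, map_add, Submodule.coe_add]
        simp only [Lp.toTemperedDistributionCLM_apply, laplacianL2_spec]
        simp only [← TemperedDistribution.laplacianCLM_apply, map_add]
      map_smul' := fun c f => by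
        rw [RingHom.id_apply, smul_neg]
        congr 1
        apply toTemperedDistribution_injective
        rw [laplacianL2_spec]
        simp only [← Lp.toTemperedDistributionCLM_apply, map_smul, Submodule.coe_smul]
        simp only [Lp.toTemperedDistributionCLM_apply, laplacianL2_spec]
        simp only [← TemperedDistribution.laplacianCLM_apply, map_smul] }

open Classical in
/-- The bounded operator of multiplication by a function `m ∈ L^∞(ℝ²)` on `L²(ℝ²)`
(by convention zero if `m ∉ L^∞`). -/
def mulOp (m : Plane → ℝ) : L2Plane →L[ℂ] L2Plane :=
  if h : MemLp (fun x => (m x : ℂ)) ∞ (volume : Measure Plane) then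
    (ContinuousLinearMap.mul ℂ ℂ).holderL volume ∞ 2 2 (h.toLp _)
  else 0

/-! ### The curve, the strip, the potential -/

/-- The signed curvature `γ = Γ₂' Γ₁'' - Γ₁' Γ₂''` of a naturally parametrized curve. -/
def curvature (Γ : ℝ → Plane) (s : ℝ) : ℝ :=
  deriv Γ s 1 * iteratedDeriv 2 Γ s 0 - deriv Γ s 0 * iteratedDeriv 2 Γ s 1

/-- The strip coordinates `x(s,u) = (Γ₁(s) - u Γ₂'(s), Γ₂(s) + u Γ₁'(s))`. -/
def stripMap (Γ : ℝ → Plane) (p : ℝ × ℝ) : Plane :=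
  !₂[Γ p.1 0 - p.2 * deriv Γ p.1 1, Γ p.1 1 + p.2 * deriv Γ p.1 0]

/-- The strip `Ω^a` of the points whose distance from the curve is less than `a`. -/
def strip (Γ : ℝ → Plane) (a : ℝ) : Set Plane := Metric.thickening a (Set.range Γ)

/-- The standing assumptions on the curve `Γ` and the strip halfwidth `a`. -/
structure CurveAssumptions (Γ : ℝ → Plane) (a : ℝ) : Prop where
  /-- the halfwidth is positive -/
  pos : 0 < a
  /-- the curve is `C²` -/
  contDiff : ContDiff ℝ 2 Γ
  /-- the curve is parametrized by its arc length -/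
  unitSpeed : ∀ s, ‖deriv Γ s‖ = 1
  /-- the curve has no self-intersections -/
  injective : Function.Injective Γ
  /-- the curve is straight outside a compact, or asymptotically straight -/
  curvature_decay : HasCompactSupport (curvature Γ) ∨
    (ContDiff ℝ 4 Γ ∧ Tendsto (curvature Γ) (cocompact ℝ) (𝓝 0) ∧
      Tendsto (deriv (curvature Γ)) (cocompact ℝ) (𝓝 0) ∧
      Tendsto (iteratedDeriv 2 (curvature Γ)) (cocompact ℝ) (𝓝 0))
  /-- `|Γ(s) - Γ(s')| → ∞` as `|s - s'| → ∞` -/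
  dist_tendsto : Tendsto (fun p : ℝ × ℝ => dist (Γ p.1) (Γ p.2))
    (comap (fun p : ℝ × ℝ => |p.1 - p.2|) atTop) atTop
  /-- `a ‖γ‖_∞ < 1` -/
  width_lt : a * (⨆ s, |curvature Γ s|) < 1
  /-- the points of the strip are uniquely parametrized by the strip coordinates -/
  stripMap_injOn : Set.InjOn (stripMap Γ) (Set.univ ×ˢ Set.Ioo (-a) a)

/-- The standing assumptions on the channel profile: a nonzero `V ≥ 0` from `L^∞(ℝ)` supported
in `[-a, a]`. -/
structure ProfileAssumptions (V : ℝ → ℝ) (a : ℝ) : Prop where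
  memLp : MemLp V ∞ (volume : Measure ℝ)
  nonneg : ∀ᵐ u : ℝ, 0 ≤ V u
  ne_zero : ¬ V =ᵐ[volume] 0
  support : ∀ᵐ u : ℝ, u ∉ Set.Icc (-a) a → V u = 0

/-- The potential `Ṽ(x(s,u)) = V(u)` for `s ∈ ℝ`, `|u| < a`, extended by zero to the plane. -/
def potential (Γ : ℝ → Plane) (a : ℝ) (V : ℝ → ℝ) : Plane → ℝ :=
  Function.extend (fun p : ℝ × Set.Ioo (-a) a => stripMap Γ (p.1, (p.2 : ℝ)))
    (fun p => V (p.2 : ℝ)) 0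

/-! ### The two operators -/

/-- The Schrödinger operator `H_{Γ,V} = -Δ - Ṽ` with domain `H²(ℝ²)`. -/
def hamiltonian (Γ : ℝ → Plane) (a : ℝ) (V : ℝ → ℝ) : L2Plane →ₗ.[ℂ] L2Plane where
  domain := negLaplacian.domain
  toFun := negLaplacian.toFun -
    (mulOp (potential Γ a V)).toLinearMap ∘ₗ negLaplacian.domain.subtype

/-- The complex Hilbert space `L²(Ω^a)`. -/
abbrev L2Strip (Γ : ℝ → Plane) (a : ℝ) : Type :=
  Lp ℂ 2 ((volume : Measure Plane).restrict (strip Γ a))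

/-- The restriction `L²(ℝ²) → L²(Ω^a)`; its adjoint is the extension by zero. -/
def restrictStrip (Γ : ℝ → Plane) (a : ℝ) : L2Plane →L[ℂ] L2Strip Γ a :=
  LpToLpRestrictCLM Plane ℂ ℂ volume 2 (strip Γ a)

/-- The Birman-Schwinger operator `K_{Γ,V}(z) = Ṽ^{1/2} (-Δ - z)⁻¹ Ṽ^{1/2}` as a bounded operator
on `L²(Ω^a)`. -/
def birmanSchwinger (Γ : ℝ → Plane) (a : ℝ) (V : ℝ → ℝ) (z : ℂ) :
    L2Strip Γ a →L[ℂ] L2Strip Γ a :=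
  restrictStrip Γ a ∘L mulOp (fun x => √(potential Γ a V x)) ∘L resolvent negLaplacian z ∘L
    mulOp (fun x => √(potential Γ a V x)) ∘L (restrictStrip Γ a).adjoint

end

end SoftWaveguide

namespace SoftWaveguide

/-! ### Self-adjoint operators -/

section SelfAdjoint

variable {X : Type*} [NormedAddCommGroup X] [InnerProductSpace ℂ X]

/-! Let `B` be multiplication by `Ṽ^{1/2}` from `L²(ℝ²)` to `L²(Ω^a)`. Then `Ṽ = B†B`, and with `R =
(-Δ - z)⁻¹` the two operators are `H = -Δ - B†B` and `K = B R B†`. The maps `x ↦ B x` and `ψ ↦ R B†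
ψ` are mutually inverse between `ker (H - z)` and `ker (K - 1)` (`IsResolventAt.rootSpaceEquiv`).

To compare isolation in the spectrum as well, it is replaced by an estimate. For a self-adjoint
operator, a real eigenvalue `t` of finite multiplicity is isolated iff the distance of `x` to the
eigenspace is at most `C ‖(A - t) x‖` (`HasGapAt`). This estimate passes between `H` and `K` through
the same two maps (`IsResolventAt.hasGapAt_iff`). For nonreal `z` neither side has an eigenvector.

Continuity, monotonicity and the norm bound follow from the first resolvent identity and from `-Δ ≥
0`, conjugated by `B`. Self-adjointness and positivity of `-Δ` on `H²` are read off from the Fourier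
multiplier `(1 + |ξ|²)⁻¹`. The geometry enters only through null sets: it makes `Ṽ` measurable,
bounded, a.e. nonnegative, zero off the strip and not a.e. zero. -/

/-- `A` is symmetric and the domain of its adjoint is not larger than the one of `A`. -/
structure IsSelfAdjointPMap (A : X →ₗ.[ℂ] X) : Prop where
  symm : ∀ x y : A.domain, inner ℂ (A x) (y : X) = inner ℂ (x : X) (A y)
  adjoint_le : ∀ y b : X, (∀ x : A.domain, inner ℂ y (A x) = inner ℂ b (x : X)) →
    ∃ h : y ∈ A.domain, A ⟨y, h⟩ = b

theorem mem_rootSpace_succ {A : X →ₗ.[ℂ] X} {z : ℂ} {n : ℕ} {x : X} :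
    x ∈ rootSpace A z (n + 1) ↔ ∃ h : x ∈ A.domain, A ⟨x, h⟩ - z • x ∈ rootSpace A z n := by
  simp only [rootSpace, Submodule.mem_map, Submodule.mem_comap]
  constructor
  · rintro ⟨y, hy, rfl⟩
    exact ⟨y.2, hy⟩
  · rintro ⟨h, hx⟩
    exact ⟨⟨x, h⟩, hx, rfl⟩

theorem mem_rootSpace_one {A : X →ₗ.[ℂ] X} {z : ℂ} {x : X} :
    x ∈ rootSpace A z 1 ↔ ∃ h : x ∈ A.domain, A ⟨x, h⟩ = z • x := by
  rw [mem_rootSpace_succ]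
  simp [rootSpace, sub_eq_zero]

variable {A : X →ₗ.[ℂ] X}

theorem IsSelfAdjointPMap.inner_sub_smul (hA : IsSelfAdjointPMap A) (z : ℂ) (x y : A.domain) :
    inner ℂ (A x - z • (x : X)) (y : X) =
      inner ℂ (x : X) (A y - (starRingEnd ℂ z) • (y : X)) := by
  rw [inner_sub_left, inner_sub_right, hA.symm, inner_smul_left, inner_smul_right]

theorem IsSelfAdjointPMap.eq_conj_of_eigenvector (hA : IsSelfAdjointPMap A) {z : ℂ} {x : A.domain}
    (hx0 : (x : X) ≠ 0) (hx : A x = z • (x : X)) : starRingEnd ℂ z = z := by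
  have h := hA.symm x x
  rw [hx, inner_smul_left, inner_smul_right] at h
  exact mul_right_cancel₀ (inner_self_ne_zero.mpr hx0) h

/-- There are no Jordan chains: if `(A - z)² x = 0` with `z` real, then `‖(A - z) x‖² = ⟨x, (A - z)²
x⟩ = 0`. -/
theorem IsSelfAdjointPMap.rootSpace_le (hA : IsSelfAdjointPMap A) {z : ℂ}
    (hz : starRingEnd ℂ z = z) (n : ℕ) : rootSpace A z n ≤ rootSpace A z 1 := by
  induction n with
  | zero => simp [rootSpace]
  | succ n ih =>
    intro x hx
    obtain ⟨h, hx⟩ := mem_rootSpace_succ.mp hx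
    obtain ⟨h', hx'⟩ := mem_rootSpace_one.mp (ih hx)
    refine mem_rootSpace_one.mpr ⟨h, ?_⟩
    rw [← sub_eq_zero, ← inner_self_eq_zero (𝕜 := ℂ)]
    have := hA.inner_sub_smul z ⟨x, h⟩ ⟨_, h'⟩
    rw [hz, hx', sub_self, inner_zero_right] at this
    exact this

theorem IsSelfAdjointPMap.iSup_rootSpace (hA : IsSelfAdjointPMap A) {z : ℂ}
    (hz : starRingEnd ℂ z = z) : (⨆ n, rootSpace A z n) = rootSpace A z 1 :=
  le_antisymm (iSup_le (hA.rootSpace_le hz)) (le_iSup (rootSpace A z) 1)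

theorem IsResolventAt.inner_comm {A : X →ₗ.[ℂ] X} (hA : IsSelfAdjointPMap A) {z : ℂ} {R : X →L[ℂ] X}
    (hz : starRingEnd ℂ z = z) (hR : IsResolventAt A z R) (x y : X) :
    inner ℂ (R x) y = inner ℂ x (R y) := by
  obtain ⟨hx, hx'⟩ := hR.1 x
  obtain ⟨hy, hy'⟩ := hR.1 y
  have := hA.inner_sub_smul z ⟨_, hx⟩ ⟨_, hy⟩
  rw [hz, hx', hy'] at this
  exact this.symm

theorem IsResolventAt.apply_mem {A : X →ₗ.[ℂ] X} {z : ℂ} {R : X →L[ℂ] X}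
    (hR : IsResolventAt A z R) (y : X) : R y ∈ A.domain := (hR.1 y).1

theorem IsResolventAt.apply_eq {A : X →ₗ.[ℂ] X} {z : ℂ} {R : X →L[ℂ] X}
    (hR : IsResolventAt A z R) (y : X) :
    A ⟨R y, hR.apply_mem y⟩ = y + z • R y := by
  rw [← sub_eq_iff_eq_add]
  exact (hR.1 y).2

theorem isResolventAt_resolvent {A : X →ₗ.[ℂ] X} {z : ℂ} (h : z ∈ resolventSet A) :
    IsResolventAt A z (resolvent A z) := by
  have h' : ∃ R : X →L[ℂ] X, IsResolventAt A z R := h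
  rw [resolvent, dif_pos h']
  exact h'.choose_spec

variable [CompleteSpace X]

/-- A self-adjoint operator `A` such that `A - z` and `A - conj z` are bounded from below has `z` in
its resolvent set. -/
theorem IsSelfAdjointPMap.mem_resolventSet (hA : IsSelfAdjointPMap A) {z : ℂ} {c : ℝ} (hc : 0 < c)
    (h1 : ∀ x : A.domain, c * ‖(x : X)‖ ≤ ‖A x - z • (x : X)‖)
    (h2 : ∀ x : A.domain, c * ‖(x : X)‖ ≤ ‖A x - (starRingEnd ℂ z) • (x : X)‖) :
    z ∈ resolventSet A := by
  let T : A.domain →ₗ[ℂ] X := A.toFun - z • A.domain.subtype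
  have hT (x : A.domain) : T x = A x - z • (x : X) := rfl
  have hT1 (x : A.domain) : c * ‖x‖ ≤ ‖T x‖ := h1 x
  have hinj : Function.Injective T := by
    rw [injective_iff_map_eq_zero]
    intro x hx
    have := hT1 x
    rw [hx, norm_zero] at this
    have h0 : ‖x‖ ≤ 0 := by
      by_contra! h
      have := mul_pos hc h
      linarith
    exact norm_le_zero_iff.mp h0
  -- The lower bound makes preimages of a convergent sequence Cauchy; their limit lies in the domain
  -- because `adjoint_le` makes `A` closed.
  have hclosed : IsClosed (LinearMap.range T : Set X) := by
    rw [← isSeqClosed_iff_isClosed]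
    intro u y hu hy
    choose x hx using hu
    have hcau : CauchySeq (fun n => (x n : X)) := by
      have hucau := hy.cauchySeq
      rw [Metric.cauchySeq_iff'] at hucau ⊢
      intro ε hε
      obtain ⟨N, hN⟩ := hucau (c * ε) (mul_pos hc hε)
      refine ⟨N, fun n hn => ?_⟩
      have h3 := hN n hn
      rw [dist_eq_norm, ← hx, ← hx, ← map_sub] at h3
      have h4 := hT1 (x n - x N)
      rw [dist_eq_norm]
      exact lt_of_mul_lt_mul_left (lt_of_le_of_lt h4 h3) hc.le
    obtain ⟨x₀, hx₀⟩ := cauchySeq_tendsto_of_complete hcau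
    have hAx : Tendsto (fun n => A (x n)) atTop (𝓝 (y + z • x₀)) := by
      refine (hy.add (hx₀.const_smul z)).congr fun n => ?_
      rw [← hx, hT]
      abel
    obtain ⟨h, hh⟩ := hA.adjoint_le x₀ (y + z • x₀) fun v => by
      refine tendsto_nhds_unique (hx₀.inner tendsto_const_nhds)
        ((hAx.inner (tendsto_const_nhds (x := (v : X)))).congr fun n => ?_)
      exact hA.symm (x n) v
    exact ⟨⟨x₀, h⟩, by rw [hT, hh]; simp⟩
  have hsurj : LinearMap.range T = ⊤ := by
    have : CompleteSpace (LinearMap.range T) := hclosed.completeSpace_coe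
    rw [← Submodule.orthogonal_eq_bot_iff, Submodule.eq_bot_iff]
    intro y hy
    -- A vector orthogonal to the range is an eigenvector of `A` at `conj z`, which the second lower
    -- bound excludes.
    have hy' : ∀ x : A.domain, inner ℂ y (A x) = inner ℂ (starRingEnd ℂ z • y) (x : X) := by
      intro x
      have := (Submodule.mem_orthogonal' _ _).mp hy (T x) ⟨x, rfl⟩
      rw [hT, inner_sub_right, inner_smul_right, sub_eq_zero] at this
      rw [this, inner_smul_left]
      simp
    obtain ⟨h, hh⟩ := hA.adjoint_le y _ hy'
    have h3 := h2 ⟨y, h⟩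
    rw [hh] at h3
    simp only [sub_self, norm_zero] at h3
    have h0 : ‖y‖ ≤ 0 := by
      by_contra! h
      have := mul_pos hc h
      linarith
    exact norm_le_zero_iff.mp h0
  let e : A.domain ≃ₗ[ℂ] X := LinearEquiv.ofBijective T ⟨hinj, LinearMap.range_eq_top.mp hsurj⟩
  have he (x : A.domain) : e x = A x - z • (x : X) := rfl
  refine ⟨LinearMap.mkContinuous (A.domain.subtype ∘ₗ (e.symm : X →ₗ[ℂ] A.domain)) c⁻¹ ?_, ?_, ?_⟩
  · intro y
    have := hT1 (e.symm y)
    rw [show T (e.symm y) = y from e.apply_symm_apply y] at this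
    rw [← div_eq_inv_mul, le_div_iff₀' hc]
    exact this
  · intro y
    exact ⟨(e.symm y).2, e.apply_symm_apply y⟩
  · intro x
    change ((e.symm (e x) : A.domain) : X) = x
    rw [e.symm_apply_apply]

/-- If `t₀` is isolated in the spectrum of a normal operator `T`, or outside the spectrum, then the
distance to the kernel of `T - t₀` is controlled by `T - t₀`. -/
theorem exists_pseudoInverse {T : X →L[ℂ] X} (hT : IsStarNormal T) {t₀ : ℂ}
    (h : ∀ᶠ w in 𝓝[≠] t₀, w ∉ spectrum ℂ T) :
    ∃ G P : X →L[ℂ] X, G * (T - t₀ • 1) = 1 - P ∧ (T - t₀ • 1) * P = 0 := by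
  classical
  -- Both functions are continuous on the spectrum because `t₀` is isolated there or absent. `cfc p
  -- T` is the spectral projection at `t₀`, and `cfc g T` inverts `T - t₀` off its range.
  let g : ℂ → ℂ := fun t => if t = t₀ then 0 else (t - t₀)⁻¹
  let p : ℂ → ℂ := fun t => if t = t₀ then 1 else 0
  have key (f k : ℂ → ℂ) (c : ℂ) (hk : ∀ t, t ≠ t₀ → ContinuousAt k t)
      (hf : f = fun t => if t = t₀ then c else k t) : ContinuousOn f (spectrum ℂ T) := by
    intro t ht
    by_cases htt : t = t₀
    · subst htt
      have : f =ᶠ[𝓝[spectrum ℂ T] t] fun _ => c := by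
        rw [eventually_nhdsWithin_iff] at h
        rw [EventuallyEq, eventually_nhdsWithin_iff]
        filter_upwards [h] with w hw hws
        have : w = t := by
          by_contra hne
          exact hw hne hws
        rw [hf, this]
        simp
      exact (continuousWithinAt_const).congr_of_eventuallyEq this (by simp [hf])
    · have : f =ᶠ[𝓝 t] k := by
        filter_upwards [isOpen_ne.mem_nhds htt] with w hw
        rw [hf]
        simp only [if_neg hw]
      exact ((hk t htt).congr this.symm).continuousWithinAt
  have hg : ContinuousOn g (spectrum ℂ T) :=
    key g (fun t => (t - t₀)⁻¹) 0 (fun t ht => by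
      have : t - t₀ ≠ 0 := sub_ne_zero.mpr ht
      fun_prop (disch := assumption)) rfl
  have hp : ContinuousOn p (spectrum ℂ T) := key p (fun _ => 0) 1 (fun t _ => by fun_prop) rfl
  have hl : cfc (fun t : ℂ => t - t₀) T = T - t₀ • 1 := by
    rw [cfc_sub (fun t => t) (fun _ => t₀) T, cfc_id' ℂ T, cfc_const t₀ T,
      Algebra.algebraMap_eq_smul_one]
  refine ⟨cfc g T, cfc p T, ?_, ?_⟩
  · rw [← hl, ← cfc_mul g _ T, ← cfc_one ℂ T, ← cfc_sub _ p T]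
    refine cfc_congr fun t _ => ?_
    by_cases ht : t = t₀
    · simp [ht, p]
    · have : t - t₀ ≠ 0 := sub_ne_zero.mpr ht
      simp [g, p, ht, this]
  · rw [← hl, ← cfc_mul _ p T, ← cfc_zero ℂ T]
    refine cfc_congr fun t _ => ?_
    by_cases ht : t = t₀
    · simp [ht]
    · simp [p, ht]

end SelfAdjoint

/-! ### Discrete spectrum and gap estimates -/

section Discrete

variable {X : Type*} [NormedAddCommGroup X] [InnerProductSpace ℂ X] {A : X →ₗ.[ℂ] X}

/-- The distance to the eigenspace of `A` at `z` is controlled by `A - z`. -/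
def HasGapAt (A : X →ₗ.[ℂ] X) (z : ℂ) : Prop :=
  ∃ C : ℝ, ∀ x : A.domain, ∃ n ∈ rootSpace A z 1, ‖(x : X) - n‖ ≤ C * ‖A x - z • (x : X)‖

/-- Spectral mapping for `w ↦ (w - μ)⁻¹`: formally `(w - μ)⁻¹ - T = (w - μ)⁻¹ (A - w)(A - μ)⁻¹`,
whose inverse is `(w - μ)(A - μ)(A - w)⁻¹ = (w - μ)(1 + (w - μ) R)`. -/
theorem IsResolventAt.isUnit_sub {μ w : ℂ} {T R : X →L[ℂ] X} (hμw : w ≠ μ)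
    (hT : IsResolventAt A μ T) (hR : IsResolventAt A w R) :
    IsUnit (algebraMap ℂ (X →L[ℂ] X) (w - μ)⁻¹ - T) := by
  have hs : w - μ ≠ 0 := sub_ne_zero.mpr hμw
  have hTR (y : X) : T (R y) = (w - μ)⁻¹ • (R y - T y) := by
    have h1 := hT.2 ⟨R y, hR.apply_mem y⟩
    rw [hR.apply_eq] at h1
    have h2 : y + w • R y - μ • R y = y + (w - μ) • R y := by module
    rw [h2, map_add, map_smul] at h1
    rw [eq_inv_smul_iff₀ hs]
    exact (eq_sub_of_add_eq' h1)
  have hRT (y : X) : R (T y) = (w - μ)⁻¹ • (R y - T y) := by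
    have h1 := hR.2 ⟨T y, hT.apply_mem y⟩
    rw [hT.apply_eq] at h1
    have h2 : y + μ • T y - w • T y = y - (w - μ) • T y := by module
    rw [h2, map_sub, map_smul] at h1
    rw [eq_inv_smul_iff₀ hs]
    exact (sub_eq_iff_eq_add.mp h1).symm ▸ (sub_eq_of_eq_add' rfl).symm
  refine isUnit_iff_exists.mpr ⟨(w - μ) • (1 + (w - μ) • R), ?_, ?_⟩
  · ext y
    simp only [Algebra.algebraMap_eq_smul_one, mul_apply_eq_comp,
      _root_.sub_apply, _root_.smul_apply, _root_.add_apply,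
      one_apply_eq_self, map_add, map_smul, hTR, smul_add, smul_smul, smul_sub]
    match_scalars <;> field_simp <;> ring
  · ext y
    simp only [Algebra.algebraMap_eq_smul_one, mul_apply_eq_comp,
      _root_.sub_apply, _root_.smul_apply, _root_.add_apply,
      one_apply_eq_self, map_sub, map_smul, hRT, smul_add, smul_smul, smul_sub]
    match_scalars <;> field_simp <;> ring

variable [CompleteSpace X]

/-- The functional calculus is available for the bounded operator `T = (A - μ)⁻¹`, in whose spectrum
`(t - μ)⁻¹` is isolated or absent; the resulting estimate is carried back to `A`. -/
theorem IsSelfAdjointPMap.hasGapAt (hA : IsSelfAdjointPMap A) {t : ℝ}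
    (h : ∀ᶠ w in 𝓝[≠] (t : ℂ), w ∈ resolventSet A) : HasGapAt A t := by
  rw [eventually_nhdsWithin_iff, Metric.eventually_nhds_iff] at h
  obtain ⟨r, hr, h⟩ := h
  -- A real `μ` makes `T` self-adjoint; half the radius keeps it inside the punctured ball of
  -- regular points.
  set μ : ℂ := ((t + r / 2 : ℝ) : ℂ) with hμ
  have hμt : (t : ℂ) - μ = ((-(r / 2) : ℝ) : ℂ) := by rw [hμ]; push_cast; ring
  have hμt0 : (t : ℂ) - μ ≠ 0 := by
    rw [hμt]; exact_mod_cast (by linarith : -(r / 2) ≠ 0)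
  obtain ⟨T, hT⟩ : μ ∈ resolventSet A := by
    refine h ?_ (fun h' => hμt0 (by rw [h', sub_self]))
    rw [dist_comm, dist_eq_norm, hμt, Complex.norm_real, Real.norm_eq_abs, abs_neg,
      abs_of_pos (by linarith)]
    linarith
  have hTsa : IsSelfAdjoint T := by
    rw [ContinuousLinearMap.isSelfAdjoint_iff_isSymmetric]
    exact hT.inner_comm hA (Complex.conj_ofReal _)
  set t₀ : ℂ := ((t : ℂ) - μ)⁻¹ with ht₀
  have ht₀0 : t₀ ≠ 0 := inv_ne_zero hμt0
  have hspec : ∀ᶠ s in 𝓝[≠] t₀, s ∉ spectrum ℂ T := by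
    have hcont : Tendsto (fun s : ℂ => μ + s⁻¹) (𝓝 t₀) (𝓝 (t : ℂ)) := by
      have : Tendsto (fun s : ℂ => μ + s⁻¹) (𝓝 t₀) (𝓝 (μ + t₀⁻¹)) :=
        (tendsto_inv₀ ht₀0).const_add μ
      rwa [ht₀, inv_inv, add_sub_cancel] at this
    rw [eventually_nhdsWithin_iff]
    filter_upwards [hcont (Metric.ball_mem_nhds _ hr), isOpen_ne.mem_nhds ht₀0] with s hs hs0 hst
    have hw : μ + s⁻¹ ∈ resolventSet A := by
      refine h hs fun h' => hst ?_
      rw [Set.mem_singleton_iff] at *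
      rw [ht₀, ← h']
      simp
    obtain ⟨R, hR⟩ := hw
    have := hT.isUnit_sub (by simpa using hs0) hR
    rw [add_sub_cancel_left, inv_inv] at this
    rw [spectrum.mem_iff, not_not]
    exact this
  obtain ⟨G, P, hGP, hP⟩ := exists_pseudoInverse hTsa.isStarNormal hspec
  refine ⟨‖T‖ * (‖G‖ * ‖t₀‖), fun x => ?_⟩
  set y : X := A x - μ • (x : X) with hy
  have hTy : T y = x := hT.2 x
  have hTP (v : X) : T (P v) = t₀ • P v := by
    have := congr($hP v)
    simpa [sub_eq_zero] using this
  have hPmem (v : X) : P v ∈ rootSpace A t 1 := by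
    have h1 : P v = t₀⁻¹ • T (P v) := by rw [hTP, inv_smul_smul₀ ht₀0]
    have h2 : P v ∈ A.domain := by
      rw [h1]
      exact A.domain.smul_mem _ (hT.apply_mem _)
    refine mem_rootSpace_one.mpr ⟨h2, ?_⟩
    have h4 := hT.apply_eq (P v)
    have h5 : (⟨T (P v), hT.apply_mem _⟩ : A.domain) = t₀ • ⟨P v, h2⟩ := Subtype.ext (hTP v)
    rw [h5, A.map_smul, hTP, ← eq_inv_smul_iff₀ ht₀0] at h4
    rw [h4, ht₀, inv_inv, smul_add, smul_smul, smul_smul]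
    have : ((t : ℂ) - μ) * μ * ((t : ℂ) - μ)⁻¹ = μ := by field_simp
    rw [this, ← add_smul, sub_add_cancel]
  have hTt : T y - t₀ • y = (-t₀) • (A x - (t : ℂ) • (x : X)) := by
    rw [hTy, hy]
    have : (x : X) = t₀ • ((t : ℂ) - μ) • (x : X) := by
      rw [smul_smul, ht₀, inv_mul_cancel₀ hμt0, one_smul]
    nth_rewrite 1 [this]
    module
  have hPy : y - P y = G ((-t₀) • (A x - (t : ℂ) • (x : X))) := by
    have := congr($hGP y)
    rw [← hTt]
    simpa using this.symm
  refine ⟨t₀ • P y, (rootSpace A t 1).smul_mem _ (hPmem y), ?_⟩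
  have hxn : (x : X) - t₀ • P y = T (y - P y) := by rw [map_sub T, hTy, hTP]
  rw [hxn, hPy, mul_assoc, mul_assoc]
  refine (T.le_opNorm _).trans (mul_le_mul_of_nonneg_left ?_ (norm_nonneg _))
  refine (G.le_opNorm _).trans (mul_le_mul_of_nonneg_left ?_ (norm_nonneg _))
  rw [norm_smul, norm_neg]

/-- On the eigenspace `A - w` acts as `t - w`. On its orthogonal complement `A - t` is bounded below
by `C⁻¹`, hence `A - w` by `(2C)⁻¹` once `|w - t| ≤ (2C)⁻¹`. Finite dimension provides the
orthogonal projection. -/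
theorem IsSelfAdjointPMap.eventually_mem_resolventSet (hA : IsSelfAdjointPMap A) {t : ℝ}
    [FiniteDimensional ℂ (rootSpace A t 1)] (h : HasGapAt A t) :
    ∀ᶠ w in 𝓝[≠] (t : ℂ), w ∈ resolventSet A := by
  obtain ⟨C₀, hC₀⟩ := h
  -- `HasGapAt` does not fix the sign of its constant.
  set C : ℝ := max C₀ 1 with hCdef
  have hCpos : 0 < C := lt_of_lt_of_le one_pos (le_max_right _ _)
  set N := rootSpace A t 1 with hN
  have hbound (w : ℂ) (hw : ‖w - t‖ ≤ (2 * C)⁻¹) (hwt : w ≠ t) (x : A.domain) :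
      (‖w - t‖⁻¹ + 2 * C)⁻¹ * ‖(x : X)‖ ≤ ‖A x - w • (x : X)‖ := by
    have hwpos : 0 < ‖w - t‖ := norm_pos_iff.mpr (sub_ne_zero.mpr hwt)
    set n : X := N.starProjection (x : X) with hn
    have hnN : n ∈ N := Submodule.starProjection_apply_mem _ _
    obtain ⟨hnD, hnA⟩ := mem_rootSpace_one.mp hnN
    set m : A.domain := x - ⟨n, hnD⟩ with hm
    have hmx : (m : X) = x - n := rfl
    have hmN : (m : X) ∈ Nᗮ := Submodule.sub_starProjection_mem_orthogonal (x : X)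
    have hAm : A x = t • n + A m := by
      have : A m = A x - A ⟨n, hnD⟩ := A.map_sub _ _
      rw [this, hnA]
      simp
    have hAmN : A m - w • (m : X) ∈ Nᗮ := by
      rw [Submodule.mem_orthogonal]
      intro v hv
      obtain ⟨hvD, hvA⟩ := mem_rootSpace_one.mp hv
      rw [inner_sub_right, ← hA.symm ⟨v, hvD⟩ m, hvA, inner_smul_left, inner_smul_right]
      rw [Submodule.inner_right_of_mem_orthogonal hv hmN]
      simp
    have hsplit : A x - w • (x : X) = ((t : ℂ) - w) • n + (A m - w • (m : X)) := by
      rw [hAm, hmx, ← Complex.coe_smul]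
      module
    have horth : inner ℂ (((t : ℂ) - w) • n) (A m - w • (m : X)) = 0 :=
      Submodule.inner_right_of_mem_orthogonal (N.smul_mem _ hnN) hAmN
    have hpyth := norm_add_sq_eq_norm_sq_add_norm_sq_of_inner_eq_zero _ _ horth
    rw [← hsplit] at hpyth
    have h1 : ‖w - t‖ * ‖n‖ ≤ ‖A x - w • (x : X)‖ := by
      rw [norm_sub_rev w, ← norm_smul]
      refine abs_le_of_sq_le_sq' ?_ (norm_nonneg _) |>.2
      nlinarith [norm_nonneg (A m - w • (m : X))]
    have h2 : ‖A m - w • (m : X)‖ ≤ ‖A x - w • (x : X)‖ := by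
      refine abs_le_of_sq_le_sq' ?_ (norm_nonneg _) |>.2
      nlinarith [norm_nonneg (((t : ℂ) - w) • n)]
    have h3 : ‖(m : X)‖ ≤ C * ‖A m - (t : ℂ) • (m : X)‖ := by
      obtain ⟨k, hk, hk'⟩ := hC₀ m
      have horth' : inner ℂ (m : X) (-k) = 0 := by
        rw [inner_neg_right, Submodule.inner_left_of_mem_orthogonal hk hmN, neg_zero]
      have hp := norm_add_sq_eq_norm_sq_add_norm_sq_of_inner_eq_zero _ _ horth'
      -- The eigenvector `k` supplied by the gap need not be the projection of `m`, but `m ⊥ k`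
      -- makes zero at least as good an approximation.
      have h4 : ‖(m : X)‖ ≤ ‖(m : X) - k‖ := by
        rw [sub_eq_add_neg]
        refine abs_le_of_sq_le_sq' ?_ (norm_nonneg _) |>.2
        nlinarith [norm_nonneg (-k)]
      exact h4.trans (hk'.trans (mul_le_mul_of_nonneg_right (le_max_left _ _) (norm_nonneg _)))
    have h4 : ‖(m : X)‖ ≤ 2 * C * ‖A m - w • (m : X)‖ := by
      have h5 : A m - (t : ℂ) • (m : X) = (A m - w • (m : X)) + (w - t) • (m : X) := by module
      have h6 : ‖A m - (t : ℂ) • (m : X)‖ ≤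
          ‖A m - w • (m : X)‖ + (2 * C)⁻¹ * ‖(m : X)‖ := by
        rw [h5]
        refine (norm_add_le _ _).trans (add_le_add_right ?_ _)
        rw [norm_smul]
        exact mul_le_mul_of_nonneg_right hw (norm_nonneg _)
      have h7 := h3.trans (mul_le_mul_of_nonneg_left h6 hCpos.le)
      have h8 : C * ((2 * C)⁻¹ * ‖(m : X)‖) = ‖(m : X)‖ / 2 := by field_simp
      rw [mul_add, h8] at h7
      linarith
    have h5 : ‖(x : X)‖ ≤ ‖n‖ + ‖(m : X)‖ := by
      have : (x : X) = n + m := by rw [hmx]; abel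
      calc ‖(x : X)‖ = ‖n + m‖ := by rw [← this]
        _ ≤ _ := norm_add_le _ _
    have h6 : ‖n‖ ≤ ‖w - t‖⁻¹ * ‖A x - w • (x : X)‖ := by
      rw [← div_eq_inv_mul, le_div_iff₀' hwpos]
      exact h1
    have h7 : ‖(m : X)‖ ≤ 2 * C * ‖A x - w • (x : X)‖ :=
      h4.trans (mul_le_mul_of_nonneg_left h2 (by positivity))
    rw [← div_eq_inv_mul, div_le_iff₀' (by positivity)]
    linarith
  rw [eventually_nhdsWithin_iff]
  filter_upwards [Metric.closedBall_mem_nhds (t : ℂ) (ε := (2 * C)⁻¹) (by positivity)] with w hw hwt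
  rw [mem_closedBall_iff_norm] at hw
  have hwpos : 0 < ‖w - t‖ := norm_pos_iff.mpr (sub_ne_zero.mpr hwt)
  -- As `t` is real, `conj w` is equally close to it, so the same lower bound serves for the
  -- adjoint.
  have hconj : ‖starRingEnd ℂ w - t‖ = ‖w - t‖ := by
    rw [← Complex.norm_conj (w - t), map_sub, Complex.conj_ofReal]
  refine hA.mem_resolventSet (c := (‖w - t‖⁻¹ + 2 * C)⁻¹) (by positivity) (hbound w hw hwt) ?_
  rw [← hconj]
  refine hbound _ (hconj.trans_le hw) fun h => hwt ?_
  have := congrArg (starRingEnd ℂ) h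
  simpa using this

/-- The discrete spectrum of a self-adjoint operator consists of the eigenvalues of finite
multiplicity with a spectral gap around them. -/
theorem IsSelfAdjointPMap.mem_discreteSpectrum_iff (hA : IsSelfAdjointPMap A) {t : ℝ} :
    (t : ℂ) ∈ discreteSpectrum A ↔ rootSpace A t 1 ≠ ⊥ ∧
      FiniteDimensional ℂ (rootSpace A t 1) ∧ HasGapAt A t := by
  have hne : (∃ x : A.domain, (x : X) ≠ 0 ∧ A x = (t : ℂ) • (x : X)) ↔ rootSpace A t 1 ≠ ⊥ := by
    rw [Submodule.ne_bot_iff]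
    constructor
    · rintro ⟨x, hx, hAx⟩
      exact ⟨x, mem_rootSpace_one.mpr ⟨x.2, hAx⟩, hx⟩
    · rintro ⟨x, hx, hx0⟩
      obtain ⟨h, hAx⟩ := mem_rootSpace_one.mp hx
      exact ⟨⟨x, h⟩, hx0, hAx⟩
  rw [discreteSpectrum, Set.mem_ofPred_eq, hA.iSup_rootSpace (Complex.conj_ofReal t), hne]
  constructor
  · rintro ⟨h1, h2, h3⟩
    exact ⟨h2, h3, hA.hasGapAt h1⟩
  · rintro ⟨h1, h2, h3⟩
    exact ⟨hA.eventually_mem_resolventSet h3, h1, h2⟩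

end Discrete

/-! ### The Birman-Schwinger principle -/

section BirmanSchwinger

variable {X Y : Type*} [NormedAddCommGroup X] [InnerProductSpace ℂ X]
  [NormedAddCommGroup Y] [InnerProductSpace ℂ Y] {A : X →ₗ.[ℂ] X}

/-- The operator `A - P` for a bounded `P`, with the domain of `A`. -/
def subBounded (A : X →ₗ.[ℂ] X) (P : X →L[ℂ] X) : X →ₗ.[ℂ] X where
  domain := A.domain
  toFun := A.toFun - P.toLinearMap ∘ₗ A.domain.subtype

theorem mem_domain_subBounded {P : X →L[ℂ] X} {x : X} :
    x ∈ (subBounded A P).domain ↔ x ∈ A.domain := Iff.rfl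

theorem subBounded_apply {P : X →L[ℂ] X} {x : X} (h : x ∈ (subBounded A P).domain) :
    subBounded A P ⟨x, h⟩ = A ⟨x, mem_domain_subBounded.mp h⟩ - P x := rfl

theorem IsSelfAdjointPMap.subBounded (hA : IsSelfAdjointPMap A) {P : X →L[ℂ] X}
    (hP : ∀ x y, inner ℂ (P x) y = inner ℂ x (P y)) : IsSelfAdjointPMap (subBounded A P) where
  symm := by
    rintro ⟨x, hx⟩ ⟨y, hy⟩
    rw [subBounded_apply, subBounded_apply, inner_sub_left, inner_sub_right, hP]
    congr 1
    exact hA.symm ⟨x, _⟩ ⟨y, _⟩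
  adjoint_le y b h := by
    obtain ⟨h1, h2⟩ := hA.adjoint_le y (b + P y) fun x => by
      have := h ⟨x, mem_domain_subBounded.mpr x.2⟩
      rw [subBounded_apply, inner_sub_right, ← hP] at this
      rw [inner_add_left, ← this, sub_add_cancel]
    refine ⟨mem_domain_subBounded.mpr h1, ?_⟩
    rw [subBounded_apply, h2, add_sub_cancel_right]

theorem isSelfAdjointPMap_ofBounded {T : X →L[ℂ] X}
    (hT : ∀ x y, inner ℂ (T x) y = inner ℂ x (T y)) : IsSelfAdjointPMap (ofBounded T) where
  symm x y := hT x y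
  adjoint_le y b h := by
    refine ⟨trivial, ?_⟩
    refine ext_inner_right ℂ fun v => ?_
    rw [← h ⟨v, trivial⟩]
    exact hT y v

theorem mem_rootSpace_ofBounded_one {T : X →L[ℂ] X} {x : X} :
    x ∈ rootSpace (ofBounded T) 1 1 ↔ T x = x := by
  rw [mem_rootSpace_one, one_smul]
  exact ⟨fun ⟨_, h⟩ => h, fun h => ⟨trivial, h⟩⟩

variable [CompleteSpace X] [CompleteSpace Y] {B : X →L[ℂ] Y} {R : X →L[ℂ] X} {z : ℂ}

theorem IsResolventAt.mem_rootSpace_subBounded (hR : IsResolventAt A z R) {x : X} :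
    x ∈ rootSpace (subBounded A (B.adjoint ∘L B)) z 1 ↔ R (B.adjoint (B x)) = x := by
  rw [mem_rootSpace_one]
  constructor
  · rintro ⟨h, hx⟩
    rw [subBounded_apply, sub_eq_iff_eq_add', ← sub_eq_iff_eq_add] at hx
    have := hR.2 ⟨x, h⟩
    rw [hx] at this
    exact this
  · intro h
    have h1 : x ∈ A.domain := h ▸ hR.apply_mem _
    refine ⟨mem_domain_subBounded.mpr h1, ?_⟩
    rw [subBounded_apply]
    have h2 := hR.apply_eq (B.adjoint (B x))
    have h3 : (⟨R (B.adjoint (B x)), hR.apply_mem _⟩ : A.domain) = ⟨x, h1⟩ := Subtype.ext h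
    rw [h3, h] at h2
    rw [h2]
    simp

/-- The two defects are related by `(H - z) R B† ψ = -B† (K - 1) ψ` and `(K - 1) B x = -B R (H - z)
x`. So each estimate is tested on the image of the given vector and the approximating eigenvector is
mapped back. -/
theorem IsResolventAt.hasGapAt_iff (hR : IsResolventAt A z R) :
    HasGapAt (subBounded A (B.adjoint ∘L B)) z ↔
      HasGapAt (ofBounded (B ∘L R ∘L B.adjoint)) 1 := by
  constructor
  · rintro ⟨C, hC⟩
    refine ⟨1 + ‖B‖ * (max C 0 * ‖B.adjoint‖), fun ψ => ?_⟩
    obtain ⟨n, hn, hn'⟩ := hC ⟨R (B.adjoint ψ), mem_domain_subBounded.mpr (hR.apply_mem _)⟩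
    rw [subBounded_apply, hR.apply_eq] at hn'
    set d : Y := ofBounded (B ∘L R ∘L B.adjoint) ψ - (1 : ℂ) • (ψ : Y) with hd
    have hd' : d = B (R (B.adjoint ψ)) - ψ := by rw [hd, one_smul]; rfl
    have h1 : B.adjoint ψ + z • R (B.adjoint ψ) - (B.adjoint ∘L B) (R (B.adjoint ψ)) -
        z • R (B.adjoint ψ) = -B.adjoint d := by
      rw [hd', map_sub, ContinuousLinearMap.comp_apply]
      abel
    rw [h1, norm_neg] at hn'
    have h2 : (ψ : Y) - B n = -d + B (R (B.adjoint ψ) - n) := by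
      rw [hd', map_sub]
      abel
    refine ⟨B n, mem_rootSpace_ofBounded_one.mpr ?_, ?_⟩
    · simp only [ContinuousLinearMap.comp_apply]
      rw [hR.mem_rootSpace_subBounded.mp hn]
    · rw [h2, add_mul, one_mul, mul_assoc, mul_assoc]
      refine (norm_add_le _ _).trans (add_le_add (norm_neg d).le ?_)
      refine (B.le_opNorm _).trans (mul_le_mul_of_nonneg_left (hn'.trans ?_) (norm_nonneg _))
      exact mul_le_mul (le_max_left _ _) (B.adjoint.le_opNorm _) (norm_nonneg _) (le_max_right _ _)
  · rintro ⟨C, hC⟩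
    refine ⟨‖R‖ + ‖R‖ * (‖B.adjoint‖ * (max C 0 * (‖B‖ * ‖R‖))), ?_⟩
    rintro ⟨x, hx⟩
    obtain ⟨ψ, hψ, hψ'⟩ := hC ⟨B x, trivial⟩
    rw [subBounded_apply]
    set f : X := A ⟨x, mem_domain_subBounded.mp hx⟩ - (B.adjoint ∘L B) x - z • x with hf
    have hRf : R f = x - R (B.adjoint (B x)) := by
      have := hR.2 ⟨x, mem_domain_subBounded.mp hx⟩
      rw [hf, sub_right_comm, map_sub, this]
      rfl
    have h1 : ofBounded (B ∘L R ∘L B.adjoint) ⟨B x, trivial⟩ - (1 : ℂ) • B x = -B (R f) := by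
      rw [hRf, map_sub, one_smul, neg_sub]
      rfl
    rw [h1, norm_neg] at hψ'
    have hKψ : B (R (B.adjoint ψ)) = ψ := mem_rootSpace_ofBounded_one.mp hψ
    refine ⟨R (B.adjoint ψ), hR.mem_rootSpace_subBounded.mpr (by rw [hKψ]), ?_⟩
    -- Here `f = (H - z) x`: the first term is the error of `x ↦ R B† B x`, the second that of
    -- replacing `B x` by the eigenvector `ψ`.
    have h2 : x - R (B.adjoint ψ) = R f + R (B.adjoint (B x - ψ)) := by
      rw [hRf, map_sub, map_sub]
      abel
    change ‖x - R (B.adjoint ψ)‖ ≤ _ * ‖f‖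
    rw [h2, add_mul, mul_assoc, mul_assoc, mul_assoc, mul_assoc]
    refine (norm_add_le _ _).trans (add_le_add (R.le_opNorm _) ?_)
    refine (R.le_opNorm _).trans (mul_le_mul_of_nonneg_left ?_ (norm_nonneg _))
    refine (B.adjoint.le_opNorm _).trans (mul_le_mul_of_nonneg_left ?_ (norm_nonneg _))
    refine hψ'.trans (mul_le_mul (le_max_left _ _) ?_ (norm_nonneg _) (le_max_right _ _))
    exact (B.le_opNorm _).trans (mul_le_mul_of_nonneg_left (R.le_opNorm _) (norm_nonneg _))

/-- The eigenspaces of `A - B† B` at `z` and of `B (A - z)⁻¹ B†` at `1` are isomorphic. -/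
noncomputable def IsResolventAt.rootSpaceEquiv (hR : IsResolventAt A z R) :
    rootSpace (subBounded A (B.adjoint ∘L B)) z 1 ≃ₗ[ℂ]
      rootSpace (ofBounded (B ∘L R ∘L B.adjoint)) 1 1 :=
  LinearEquiv.ofLinearMap
    (B.toLinearMap.restrict fun x hx => mem_rootSpace_ofBounded_one.mpr (by
      change B (R (B.adjoint (B x))) = B x
      rw [hR.mem_rootSpace_subBounded.mp hx]))
    ((R ∘L B.adjoint).toLinearMap.restrict fun ψ hψ => hR.mem_rootSpace_subBounded.mpr (by
      have : B (R (B.adjoint ψ)) = ψ := mem_rootSpace_ofBounded_one.mp hψ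
      change R (B.adjoint (B (R (B.adjoint ψ)))) = R (B.adjoint ψ)
      rw [this]))
    (by ext ψ; exact mem_rootSpace_ofBounded_one.mp ψ.2)
    (by ext x; exact hR.mem_rootSpace_subBounded.mp x.2)

/-- The Birman-Schwinger principle for the discrete spectrum. -/
theorem IsResolventAt.mem_discreteSpectrum_iff (hA : IsSelfAdjointPMap A)
    (hR : IsResolventAt A z R) :
    z ∈ discreteSpectrum (subBounded A (B.adjoint ∘L B)) ↔
      1 ∈ discreteSpectrum (ofBounded (B ∘L R ∘L B.adjoint)) := by
  have hH : IsSelfAdjointPMap (subBounded A (B.adjoint ∘L B)) :=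
    hA.subBounded fun x y => by
      simp only [ContinuousLinearMap.comp_apply, ContinuousLinearMap.adjoint_inner_left,
        ContinuousLinearMap.adjoint_inner_right]
  by_cases hz : starRingEnd ℂ z = z
  · have hK : IsSelfAdjointPMap (ofBounded (B ∘L R ∘L B.adjoint)) :=
      isSelfAdjointPMap_ofBounded fun x y => by
        simp only [ContinuousLinearMap.comp_apply]
        rw [← ContinuousLinearMap.adjoint_inner_right, hR.inner_comm hA hz,
          ContinuousLinearMap.adjoint_inner_left]
    obtain ⟨t, rfl⟩ := Complex.conj_eq_iff_real.mp hz
    rw [hH.mem_discreteSpectrum_iff, ← Complex.ofReal_one, hK.mem_discreteSpectrum_iff,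
      Complex.ofReal_one, hR.hasGapAt_iff]
    have e := hR.rootSpaceEquiv (B := B)
    rw [← Submodule.nontrivial_iff_ne_bot, ← Submodule.nontrivial_iff_ne_bot,
      e.toEquiv.nontrivial_congr,
      show FiniteDimensional ℂ _ ↔ FiniteDimensional ℂ _ from Module.Finite.equiv_iff e]
  -- For nonreal `z` self-adjointness of `K` is not available, so its eigenvector is carried to one
  -- of `H`, whose eigenvalues are real.
  · refine iff_of_false ?_ ?_
    · rintro ⟨-, ⟨x, hx0, hx⟩, -⟩
      exact hz (hH.eq_conj_of_eigenvector hx0 hx)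
    · rintro ⟨-, ⟨ψ, hψ0, hψ⟩, -⟩
      rw [one_smul] at hψ
      have hψ' : B (R (B.adjoint ψ)) = ψ := hψ
      have h1 : R (B.adjoint ψ) ∈ rootSpace (subBounded A (B.adjoint ∘L B)) z 1 :=
        hR.mem_rootSpace_subBounded.mpr (by rw [hψ'])
      obtain ⟨h2, h3⟩ := mem_rootSpace_one.mp h1
      refine hz (hH.eq_conj_of_eigenvector (x := ⟨_, h2⟩) (fun h0 => hψ0 ?_) h3)
      rw [← hψ', show R (B.adjoint ψ) = 0 from h0, map_zero]

end BirmanSchwinger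

/-! ### Nonnegative self-adjoint operators -/

section Nonneg

variable {X Y : Type*} [NormedAddCommGroup X] [InnerProductSpace ℂ X]
  [NormedAddCommGroup Y] [InnerProductSpace ℂ Y] {A : X →ₗ.[ℂ] X}

/-- In `⟨x, (A - z) x⟩ = ⟨x, A x⟩ - z ‖x‖²` the first term is real and nonnegative. Imaginary and
real parts bound the modulus below by `|Im z| ‖x‖²` and `-Re z ‖x‖²`, and one of these coefficients
is positive off `[0, ∞)`. -/
theorem IsSelfAdjointPMap.mem_resolventSet_of_nonneg [CompleteSpace X] (hA : IsSelfAdjointPMap A)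
    (hpos : ∀ x : A.domain, 0 ≤ (inner ℂ (x : X) (A x)).re) {z : ℂ}
    (hz : ¬ ∃ t : ℝ, 0 ≤ t ∧ z = (t : ℂ)) : z ∈ resolventSet A := by
  have hc : 0 < max |z.im| (-z.re) := by
    by_contra! h
    obtain ⟨h1, h2⟩ := max_le_iff.mp h
    have h3 : z.im = 0 := abs_nonpos_iff.mp h1
    exact hz ⟨z.re, by linarith, Complex.ext (by simp) (by simp [h3])⟩
  have key (w : ℂ) (x : A.domain) :
      max |w.im| (-w.re) * ‖(x : X)‖ ≤ ‖A x - w • (x : X)‖ := by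
    by_cases hx : ‖(x : X)‖ = 0
    · rw [hx, mul_zero]
      exact norm_nonneg _
    have hx' : 0 < ‖(x : X)‖ := lt_of_le_of_ne (norm_nonneg _) (Ne.symm hx)
    refine le_of_mul_le_mul_right ?_ hx'
    have him : (inner ℂ (x : X) (A x)).im = 0 := by
      rw [← Complex.conj_eq_iff_im, inner_conj_symm, hA.symm]
    have h1 : inner ℂ (x : X) (A x - w • (x : X)) =
        inner ℂ (x : X) (A x) - w * ((‖(x : X)‖ ^ 2 : ℝ) : ℂ) := by
      rw [inner_sub_right, inner_smul_right, inner_self_eq_norm_sq_to_K]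
      norm_cast
    have h2 : ‖inner ℂ (x : X) (A x - w • (x : X))‖ ≤ ‖A x - w • (x : X)‖ * ‖(x : X)‖ := by
      rw [mul_comm]
      exact norm_inner_le_norm _ _
    refine le_trans ?_ h2
    rw [h1, mul_assoc, ← sq, max_mul_of_nonneg _ _ (sq_nonneg _)]
    refine max_le ?_ ?_
    · refine le_trans (le_of_eq ?_) (Complex.abs_im_le_norm _)
      rw [Complex.sub_im, him, Complex.im_mul_ofReal, zero_sub, abs_neg, abs_mul,
        abs_of_nonneg (sq_nonneg ‖(x : X)‖)]
    · refine le_trans ?_ (Complex.re_le_norm _)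
      rw [Complex.sub_re, Complex.re_mul_ofReal]
      linarith [hpos x]
  refine hA.mem_resolventSet hc (key z) ?_
  have := key (starRingEnd ℂ z)
  rwa [Complex.conj_im, Complex.conj_re, abs_neg] at this

/-- The first resolvent identity. -/
theorem IsResolventAt.sub_eq {z₁ z₂ : ℂ} {R₁ R₂ : X →L[ℂ] X} (h1 : IsResolventAt A z₁ R₁)
    (h2 : IsResolventAt A z₂ R₂) (f : X) : R₁ f = R₂ f + (z₁ - z₂) • R₁ (R₂ f) := by
  have h := h1.2 ⟨R₂ f, h2.apply_mem f⟩
  rw [h2.apply_eq] at h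
  change R₁ (f + z₂ • R₂ f - z₁ • R₂ f) = R₂ f at h
  rw [map_sub, map_add, map_smul, map_smul] at h
  linear_combination (norm := module) h

variable {R R₁ R₂ : X →L[ℂ] X} {κ κ₁ κ₂ : ℝ}

theorem IsResolventAt.re_inner_apply (hR : IsResolventAt A (-(κ : ℂ) ^ 2) R) (f : X) :
    (inner ℂ (R f) f).re =
      (inner ℂ (R f) (A ⟨R f, hR.apply_mem f⟩)).re + κ ^ 2 * ‖R f‖ ^ 2 := by
  have h : f = A ⟨R f, hR.apply_mem f⟩ + ((κ ^ 2 : ℝ) : ℂ) • R f := by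
    rw [hR.apply_eq]
    push_cast
    module
  have h' := congrArg (inner ℂ (R f)) h
  rw [h', inner_add_right, inner_smul_right, Complex.add_re, Complex.re_ofReal_mul,
    inner_self_eq_norm_sq_to_K]
  norm_cast

theorem IsResolventAt.norm_le (hpos : ∀ x : A.domain, 0 ≤ (inner ℂ (x : X) (A x)).re)
    (hκ : 0 < κ) (hR : IsResolventAt A (-(κ : ℂ) ^ 2) R) : ‖R‖ ≤ (κ ^ 2)⁻¹ := by
  refine R.opNorm_le_bound (by positivity) fun f => ?_
  rw [← div_eq_inv_mul, le_div_iff₀' (by positivity)]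
  by_cases hx : ‖R f‖ = 0
  · rw [hx, mul_zero]
    exact norm_nonneg _
  have hx' : 0 < ‖R f‖ := lt_of_le_of_ne (norm_nonneg _) (Ne.symm hx)
  refine le_of_mul_le_mul_right ?_ hx'
  have h1 := hR.re_inner_apply f
  have h2 := hpos ⟨R f, hR.apply_mem f⟩
  have h3 : (inner ℂ (R f) f).re ≤ ‖R f‖ * ‖f‖ :=
    (Complex.re_le_norm _).trans (norm_inner_le_norm _ _)
  change 0 ≤ (inner ℂ (R f) (A ⟨R f, hR.apply_mem f⟩)).re at h2
  nlinarith

/-- Strict monotonicity of the resolvent of a nonnegative operator. -/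
theorem IsResolventAt.re_inner_lt (hA : IsSelfAdjointPMap A)
    (hpos : ∀ x : A.domain, 0 ≤ (inner ℂ (x : X) (A x)).re) (hκ₁ : 0 < κ₁) (hκ : κ₁ < κ₂)
    (h1 : IsResolventAt A (-(κ₁ : ℂ) ^ 2) R₁) (h2 : IsResolventAt A (-(κ₂ : ℂ) ^ 2) R₂) {f : X}
    (hf : f ≠ 0) : (inner ℂ f (R₂ f)).re < (inner ℂ f (R₁ f)).re := by
  set c : ℝ := κ₂ ^ 2 - κ₁ ^ 2 with hc
  have hc0 : 0 < c := by
    rw [hc]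
    nlinarith
  have hcz : -(κ₁ : ℂ) ^ 2 - -(κ₂ : ℂ) ^ 2 = (c : ℂ) := by
    rw [hc]
    push_cast
    ring
  have hconj : starRingEnd ℂ (-(κ₁ : ℂ) ^ 2) = -(κ₁ : ℂ) ^ 2 := by simp
  set g := R₂ f with hg
  have hg0 : g ≠ 0 := by
    intro h
    apply hf
    have := h2.apply_eq f
    have h0 : (⟨R₂ f, h2.apply_mem f⟩ : A.domain) = 0 := Subtype.ext h
    rw [h0, ← hg, h] at this
    simpa using this.symm
  have hid := h1.sub_eq h2 f
  rw [hcz, ← hg] at hid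
  have hR₁g : 0 ≤ (inner ℂ (R₁ g) g).re := by
    rw [h1.re_inner_apply]
    have := hpos ⟨R₁ g, h1.apply_mem g⟩
    change 0 ≤ (inner ℂ (R₁ g) (A ⟨R₁ g, h1.apply_mem g⟩)).re at this
    positivity
  -- With `g = R₂ f` the resolvent identity reads `R₁ f = g + c R₁ g`, so the gain in the form is `c
  -- ⟨f, R₁ g⟩ = c ⟨R₁ f, g⟩`, and the term `‖g‖²` makes it strict.
  have h3 : (inner ℂ f (R₁ g)).re = ‖g‖ ^ 2 + c * (inner ℂ (R₁ g) g).re := by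
    rw [← h1.inner_comm hA hconj, hid, inner_add_left, inner_smul_left, Complex.conj_ofReal,
      Complex.add_re, Complex.re_ofReal_mul, inner_self_eq_norm_sq_to_K]
    norm_cast
  have hgpos : 0 < ‖g‖ ^ 2 := by
    have := norm_pos_iff.mpr hg0
    positivity
  have h4 : 0 < (inner ℂ f (R₁ g)).re := by
    rw [h3]
    positivity
  rw [hid, inner_add_right, inner_smul_right, Complex.add_re, Complex.re_ofReal_mul]
  nlinarith

/-- The norm continuity of the resolvent of a nonnegative operator. -/
theorem continuousOn_of_isResolventAt {R : ℝ → X →L[ℂ] X}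
    (hpos : ∀ x : A.domain, 0 ≤ (inner ℂ (x : X) (A x)).re)
    (hR : ∀ κ : ℝ, 0 < κ → IsResolventAt A (-(κ : ℂ) ^ 2) (R κ)) : ContinuousOn R (Set.Ioi 0) := by
  intro κ₀ hκ₀
  have hκ₀' : κ₀ ^ 2 ≠ 0 := (pow_pos hκ₀ 2).ne'
  rw [ContinuousWithinAt, tendsto_iff_norm_sub_tendsto_zero]
  have hlim : Tendsto (fun κ : ℝ => |κ₀ ^ 2 - κ ^ 2| * ((κ ^ 2)⁻¹ * (κ₀ ^ 2)⁻¹))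
      (𝓝[Set.Ioi 0] κ₀) (𝓝 0) := by
    have : ContinuousAt (fun κ : ℝ => |κ₀ ^ 2 - κ ^ 2| * ((κ ^ 2)⁻¹ * (κ₀ ^ 2)⁻¹)) κ₀ := by
      fun_prop (disch := assumption)
    have h := this.tendsto.mono_left (nhdsWithin_le_nhds (s := Set.Ioi 0))
    simpa using h
  refine squeeze_zero' (Eventually.of_forall fun _ => norm_nonneg _) ?_ hlim
  filter_upwards [self_mem_nhdsWithin] with κ hκ
  have h1 : R κ - R κ₀ = ((κ₀ ^ 2 - κ ^ 2 : ℝ) : ℂ) • (R κ ∘L R κ₀) := by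
    ext f
    rw [_root_.sub_apply, (hR κ hκ).sub_eq (hR κ₀ hκ₀) f, add_sub_cancel_left]
    push_cast
    rw [neg_sub_neg]
    rfl
  rw [h1, norm_smul, Complex.norm_real, Real.norm_eq_abs]
  refine mul_le_mul_of_nonneg_left ?_ (abs_nonneg _)
  refine (ContinuousLinearMap.opNorm_comp_le _ _).trans ?_
  exact mul_le_mul ((hR κ hκ).norm_le hpos hκ) ((hR κ₀ hκ₀).norm_le hpos hκ₀) (norm_nonneg _)
    (by positivity)

theorem IsResolventAt.isPositive_sub (hA : IsSelfAdjointPMap A)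
    (hpos : ∀ x : A.domain, 0 ≤ (inner ℂ (x : X) (A x)).re) (hκ₁ : 0 < κ₁) (hκ : κ₁ < κ₂)
    (h1 : IsResolventAt A (-(κ₁ : ℂ) ^ 2) R₁) (h2 : IsResolventAt A (-(κ₂ : ℂ) ^ 2) R₂) :
    (R₁ - R₂).IsPositive := by
  refine ⟨fun x y => ?_, fun f => ?_⟩
  · change inner ℂ (R₁ x - R₂ x) y = inner ℂ x (R₁ y - R₂ y)
    rw [inner_sub_left, inner_sub_right, h1.inner_comm hA (by simp), h2.inner_comm hA (by simp)]
  · change 0 ≤ (inner ℂ (R₁ f - R₂ f) f).re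
    rw [inner_sub_left, Complex.sub_re, sub_nonneg, h1.inner_comm hA (by simp),
      h2.inner_comm hA (by simp)]
    by_cases hf : f = 0
    · simp [hf]
    · exact (h1.re_inner_lt hA hpos hκ₁ hκ h2 hf).le

end Nonneg

/-! ### Multiplication operators -/

section MulOp

variable {m : Plane → ℝ}

theorem mulOp_coeFn (hm : MemLp m ∞ volume) (f : L2Plane) :
    mulOp m f =ᵐ[volume] fun x => (m x : ℂ) * f x := by
  have h : MemLp (fun x => (m x : ℂ)) ∞ (volume : Measure Plane) := hm.ofReal
  rw [mulOp, dif_pos h]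
  have h1 := ContinuousLinearMap.coeFn_holder (r := 2) (ContinuousLinearMap.mul ℂ ℂ)
    (h.toLp _) f
  filter_upwards [h1, h.coeFn_toLp] with x hx hx'
  refine hx.trans ?_
  rw [hx']
  rfl

theorem inner_mulOp_comm (hm : MemLp m ∞ volume) (f g : L2Plane) :
    inner ℂ (mulOp m f) g = inner ℂ f (mulOp m g) := by
  rw [L2.inner_def, L2.inner_def]
  refine integral_congr_ae ?_
  filter_upwards [mulOp_coeFn hm f, mulOp_coeFn hm g] with x hf hg
  rw [hf, hg]
  simp only [RCLike.inner_apply, map_mul, Complex.conj_ofReal]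
  ring

theorem norm_mulOp_le {c : ℝ} (hc : 0 ≤ c) (hm : MemLp m ∞ volume) (h : ∀ᵐ x, |m x| ≤ c) :
    ‖mulOp m‖ ≤ c := by
  refine ContinuousLinearMap.opNorm_le_bound _ hc fun f => ?_
  refine Lp.norm_le_mul_norm_of_ae_le_mul ?_
  filter_upwards [mulOp_coeFn hm f, h] with x h1 h2
  rw [h1, norm_mul, Complex.norm_real, Real.norm_eq_abs]
  exact mul_le_mul_of_nonneg_right h2 (norm_nonneg _)

end MulOp

/-! ### The Laplacian -/

section Laplace

open FourierTransform TemperedDistribution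

/-- The Fourier multiplier with the symbol `(1 + |ξ|²)⁻¹` on `L²(ℝ²)`. -/
noncomputable def besselOp (f : L2Plane) : L2Plane :=
  𝓕⁻ (mulOp (fun x => (1 + ‖x‖ ^ 2) ^ (-1 : ℝ)) (𝓕 f))

theorem besselSymbol_memLp :
    MemLp (fun x : Plane => (1 + ‖x‖ ^ 2) ^ (-1 : ℝ)) ∞ (volume : Measure Plane) := by
  refine memLp_top_of_bound ?_ 1 (Eventually.of_forall fun x => ?_)
  · have : Function.HasTemperateGrowth (fun x : Plane => (1 + ‖x‖ ^ 2) ^ (-1 : ℝ)) := by fun_prop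
    exact this.1.continuous.aestronglyMeasurable
  · rw [Real.norm_eq_abs, abs_of_nonneg (by positivity)]
    exact Real.rpow_le_one_of_one_le_of_nonpos (by simp) (by norm_num)

theorem besselOp_toTemperedDistribution (f : L2Plane) :
    (besselOp f : 𝓢'(Plane, ℂ)) = besselPotential Plane ℂ (-2) (f : 𝓢'(Plane, ℂ)) := by
  have hm := besselSymbol_memLp.ofReal (K := ℂ)
  have h1 : mulOp (fun x => (1 + ‖x‖ ^ 2) ^ (-1 : ℝ)) (𝓕 f) =
      (hm.toLp _ • 𝓕 f : Lp ℂ 2 (volume : Measure Plane)) := by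
    refine Lp.ext ?_
    filter_upwards [mulOp_coeFn besselSymbol_memLp (𝓕 f), hm.coeFn_toLp,
      Lp.coeFn_lpSMul (r := 2) (hm.toLp _) (𝓕 f)] with x h2 h3 h4
    rw [h2, h4, Pi.smul_apply', h3]
    rfl
  rw [besselOp, h1, ← Lp.fourierInv_toTemperedDistribution_eq,
    Lp.toTemperedDistribution_smul_eq (by fun_prop), ← Lp.fourier_toTemperedDistribution_eq,
    besselPotential, fourierMultiplierCLM_apply]
  norm_num

/-- The Fourier transform has kernel `exp(-2πi⟨x, ξ⟩)`, so `Δ` has the symbol `-(2π)² |ξ|²`; hence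
the factor. -/
theorem besselPotential_two_apply (f : 𝓢'(Plane, ℂ)) :
    besselPotential Plane ℂ 2 f = f - (((2 * Real.pi) ^ 2 : ℝ) : ℂ)⁻¹ • Δ f := by
  have h1 : (fun x : Plane => (((1 + ‖x‖ ^ 2) ^ ((2 : ℝ) / 2) : ℝ) : ℂ)) =
      (fun _ => (1 : ℂ)) + fun x => Complex.ofReal (‖x‖ ^ 2) := by
    ext x
    simp
  rw [besselPotential, h1, fourierMultiplierCLM_apply,
    smulLeftCLM_add (by fun_prop) (by fun_prop), _root_.add_apply, smulLeftCLM_const, one_smul,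
    FourierTransform.fourierInv_add, fourierInv_fourier_eq, laplacian_eq_fourierMultiplierCLM,
    fourierMultiplierCLM_apply, neg_smul, smul_neg, sub_neg_eq_add, ← Complex.coe_smul,
    inv_smul_smul₀]
  exact_mod_cast (by positivity : ((2 * Real.pi) ^ 2 : ℝ) ≠ 0)

/-- The equation `-Δ f = g` is equivalent to `(1 - (2π)⁻² Δ) f = f + (2π)⁻² g`, and `besselOp`
inverts the left side. Distributions are thereby eliminated: the domain is the range of a symmetric
operator on `L²`. -/
theorem mem_negLaplacian_iff {f g : L2Plane} :
    (∃ h : f ∈ negLaplacian.domain, negLaplacian ⟨f, h⟩ = g) ↔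
      f = besselOp (f + (((2 * Real.pi) ^ 2 : ℝ) : ℂ)⁻¹ • g) := by
  set c : ℂ := (((2 * Real.pi) ^ 2 : ℝ) : ℂ)⁻¹ with hc
  have hc0 : c ≠ 0 := by
    rw [hc]
    refine inv_ne_zero ?_
    exact_mod_cast (by positivity : ((2 * Real.pi) ^ 2 : ℝ) ≠ 0)
  have hcoe : ((f + c • g : L2Plane) : 𝓢'(Plane, ℂ)) =
      (f : 𝓢'(Plane, ℂ)) + c • (g : 𝓢'(Plane, ℂ)) := by
    simp only [← Lp.toTemperedDistributionCLM_apply, map_add, map_smul]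
  have hiff : f = besselOp (f + c • g) ↔ Δ (f : 𝓢'(Plane, ℂ)) = -(g : 𝓢'(Plane, ℂ)) := by
    have : f = besselOp (f + c • g) ↔
        (f : 𝓢'(Plane, ℂ)) = (besselOp (f + c • g) : 𝓢'(Plane, ℂ)) :=
      ⟨fun h => congrArg _ h, toTemperedDistribution_injective⟩
    rw [this, besselOp_toTemperedDistribution, eq_comm, besselPotential_neg_apply_eq_iff,
      besselPotential_two_apply, hcoe, sub_eq_add_neg, add_right_inj, ← hc,
      show -(c • Δ (f : 𝓢'(Plane, ℂ))) = c • (-Δ (f : 𝓢'(Plane, ℂ))) from (smul_neg _ _).symm,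
      (smul_right_injective _ hc0).eq_iff, neg_eq_iff_eq_neg]
  rw [hiff]
  have hneg : ((-g : L2Plane) : 𝓢'(Plane, ℂ)) = -(g : 𝓢'(Plane, ℂ)) := by
    simp only [← Lp.toTemperedDistributionCLM_apply, map_neg]
  constructor
  · rintro ⟨h, rfl⟩
    rw [← hneg]
    change _ = ((- -laplacianL2 ⟨f, h⟩ : L2Plane) : 𝓢'(Plane, ℂ))
    rw [neg_neg]
    exact (laplacianL2_spec ⟨f, h⟩).symm
  · intro h
    have hmem : f ∈ sobolevH2 := by
      refine ⟨f + c • g, ?_⟩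
      rw [besselPotential_two_apply, h, hcoe, ← hc, smul_neg, sub_neg_eq_add]
    refine ⟨hmem, ?_⟩
    change -laplacianL2 ⟨f, hmem⟩ = g
    rw [neg_eq_iff_eq_neg]
    apply toTemperedDistribution_injective
    rw [laplacianL2_spec, hneg]
    exact h

theorem inner_besselOp_comm (f g : L2Plane) :
    inner ℂ (besselOp f) g = inner ℂ f (besselOp g) := by
  rw [besselOp, besselOp, ← Lp.inner_fourier_eq, ← Lp.inner_fourier_eq f, fourier_fourierInv_eq,
    fourier_fourierInv_eq, inner_mulOp_comm besselSymbol_memLp]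

/-- With the symbol `b ∈ (0, 1]`, Plancherel turns the form into `∫ b (1 - b) |φ|²`. Up to the
factor `(2π)²` it is the form of `-Δ` at `besselOp f`. -/
theorem re_inner_besselOp_sub_nonneg (f : L2Plane) :
    0 ≤ (inner ℂ (besselOp f) (f - besselOp f)).re := by
  set M := mulOp (fun x : Plane => (1 + ‖x‖ ^ 2) ^ (-1 : ℝ)) with hM
  set φ : L2Plane := 𝓕 f with hφ
  have h1 : inner ℂ (besselOp f) (f - besselOp f) = inner ℂ (M φ) (φ - M φ) := by
    rw [← Lp.inner_fourier_eq, sub_eq_add_neg, FourierTransform.fourier_add,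
      FourierTransform.fourier_neg, besselOp, fourier_fourierInv_eq, ← sub_eq_add_neg]
  rw [h1, L2.inner_def]
  have h2 : (fun x => inner ℂ (M φ x) ((φ - M φ : L2Plane) x)) =ᵐ[volume] fun x =>
      (((1 + ‖x‖ ^ 2) ^ (-1 : ℝ) * (1 - (1 + ‖x‖ ^ 2) ^ (-1 : ℝ)) * ‖φ x‖ ^ 2 : ℝ) : ℂ) := by
    filter_upwards [mulOp_coeFn besselSymbol_memLp φ, Lp.coeFn_sub φ (M φ)] with x h3 h4
    rw [h4, Pi.sub_apply, h3]
    simp only [RCLike.inner_apply, map_mul, Complex.conj_ofReal]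
    push_cast
    rw [← Complex.conj_mul']
    ring
  rw [integral_congr_ae h2, integral_complex_ofReal, Complex.ofReal_re]
  refine integral_nonneg fun x => ?_
  have h5 : (1 + ‖x‖ ^ 2) ^ (-1 : ℝ) ≤ 1 :=
    Real.rpow_le_one_of_one_le_of_nonpos (by simp) (by norm_num)
  have h6 : 0 ≤ (1 + ‖x‖ ^ 2) ^ (-1 : ℝ) := by positivity
  exact mul_nonneg (mul_nonneg h6 (sub_nonneg.mpr h5)) (sq_nonneg _)

theorem besselOp_mem_domain (h : L2Plane) : ∃ hm : besselOp h ∈ negLaplacian.domain,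
    negLaplacian ⟨besselOp h, hm⟩ = (((2 * Real.pi) ^ 2 : ℝ) : ℂ) • (h - besselOp h) := by
  rw [mem_negLaplacian_iff, inv_smul_smul₀, add_sub_cancel]
  exact_mod_cast (by positivity : ((2 * Real.pi) ^ 2 : ℝ) ≠ 0)

theorem exists_eq_besselOp (x : negLaplacian.domain) : ∃ h : L2Plane, (x : L2Plane) = besselOp h ∧
    negLaplacian x = (((2 * Real.pi) ^ 2 : ℝ) : ℂ) • (h - besselOp h) := by
  have hx := mem_negLaplacian_iff.mp ⟨x.2, rfl⟩
  refine ⟨_, hx, ?_⟩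
  obtain ⟨h1, h2⟩ := besselOp_mem_domain
    (x + (((2 * Real.pi) ^ 2 : ℝ) : ℂ)⁻¹ • negLaplacian ⟨(x : L2Plane), x.2⟩)
  rw [← h2]
  congr 1
  exact Subtype.ext hx

/-- On `x = besselOp h` the operator is `(2π)² (h - besselOp h)`, so symmetry is that of `besselOp`.
Testing the adjoint relation on all `besselOp v` yields the equation of `mem_negLaplacian_iff`. -/
theorem isSelfAdjointPMap_negLaplacian : IsSelfAdjointPMap negLaplacian where
  symm x y := by
    obtain ⟨h, hx, hAx⟩ := exists_eq_besselOp x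
    obtain ⟨k, hy, hAy⟩ := exists_eq_besselOp y
    rw [hAx, hAy, hx, hy, inner_smul_left, inner_smul_right, Complex.conj_ofReal, inner_sub_left,
      inner_sub_right, inner_besselOp_comm h k]
  adjoint_le y b h := by
    refine mem_negLaplacian_iff.mpr (ext_inner_right ℂ fun v => ?_)
    obtain ⟨hv, hAv⟩ := besselOp_mem_domain v
    have h1 := h ⟨_, hv⟩
    have hc : (((2 * Real.pi) ^ 2 : ℝ) : ℂ) ≠ 0 := by
      exact_mod_cast (by positivity : ((2 * Real.pi) ^ 2 : ℝ) ≠ 0)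
    rw [hAv, inner_smul_right, ← eq_inv_mul_iff_mul_eq₀ hc, inner_sub_right,
      sub_eq_iff_eq_add'] at h1
    rw [h1, inner_besselOp_comm, inner_add_left, inner_smul_left, map_inv₀, Complex.conj_ofReal]

theorem negLaplacian_nonneg (x : negLaplacian.domain) :
    0 ≤ (inner ℂ (x : L2Plane) (negLaplacian x)).re := by
  obtain ⟨h, hx, hAx⟩ := exists_eq_besselOp x
  rw [hAx, hx, inner_smul_right, Complex.re_ofReal_mul]
  exact mul_nonneg (by positivity) (re_inner_besselOp_sub_nonneg h)

end Laplace

/-! ### The strip coordinates -/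

section Strip

/-- The identification of `ℝ × ℝ` with the Euclidean plane. -/
def planeEquiv : ℝ × ℝ ≃ᵐ Plane :=
  MeasurableEquiv.finTwoArrow.symm.trans (MeasurableEquiv.toLp 2 (Fin 2 → ℝ))

theorem measurePreserving_planeEquiv : MeasurePreserving planeEquiv :=
  (volume_preserving_finTwoArrow ℝ).symm.trans (PiLp.volume_preserving_toLp (Fin 2))

/-- The strip coordinates as a map of `ℝ × ℝ`. -/
noncomputable def stripProd (Γ : ℝ → Plane) (p : ℝ × ℝ) : ℝ × ℝ :=
  (Γ p.1 0 - p.2 * deriv Γ p.1 1, Γ p.1 1 + p.2 * deriv Γ p.1 0)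

theorem planeEquiv_stripProd (Γ : ℝ → Plane) (p : ℝ × ℝ) :
    planeEquiv (stripProd Γ p) = stripMap Γ p := rfl

variable {Γ : ℝ → Plane} {a : ℝ} {V : ℝ → ℝ}

/-- The derivative of the strip coordinates. -/
noncomputable def stripDeriv (Γ : ℝ → Plane) (p : ℝ × ℝ) : ℝ × ℝ →L[ℝ] ℝ × ℝ :=
  LinearMap.toContinuousLinearMap (Matrix.toLin (Module.Basis.finTwoProd ℝ)
    (Module.Basis.finTwoProd ℝ)
    !![deriv Γ p.1 0 - p.2 * iteratedDeriv 2 Γ p.1 1, -deriv Γ p.1 1;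
      deriv Γ p.1 1 + p.2 * iteratedDeriv 2 Γ p.1 0, deriv Γ p.1 0])

theorem CurveAssumptions.det_stripDeriv (hΓ : CurveAssumptions Γ a) (p : ℝ × ℝ) :
    (stripDeriv Γ p).det = 1 + p.2 * curvature Γ p.1 := by
  have h1 : deriv Γ p.1 0 ^ 2 + deriv Γ p.1 1 ^ 2 = 1 := by
    have := EuclideanSpace.real_norm_sq_eq (deriv Γ p.1)
    rw [hΓ.unitSpeed, Fin.sum_univ_two] at this
    linarith
  change LinearMap.det _ = _
  rw [stripDeriv, LinearMap.coe_toContinuousLinearMap, LinearMap.det_toLin, Matrix.det_fin_two_of,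
    curvature]
  linear_combination h1

theorem CurveAssumptions.hasDerivAt (hΓ : CurveAssumptions Γ a) (s : ℝ) (i : Fin 2) :
    HasDerivAt (fun s => Γ s i) (deriv Γ s i) s :=
  (EuclideanSpace.proj i : Plane →L[ℝ] ℝ).hasFDerivAt.comp_hasDerivAt s
    (hΓ.contDiff.differentiable (by norm_num) s).hasDerivAt

theorem CurveAssumptions.contDiff_deriv (hΓ : CurveAssumptions Γ a) : ContDiff ℝ 1 (deriv Γ) := by
  have h : ContDiff ℝ (1 + 1) Γ := by
    rw [one_add_one_eq_two]
    exact hΓ.contDiff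
  exact (contDiff_succ_iff_deriv.mp h).2.2

theorem CurveAssumptions.hasDerivAt_deriv (hΓ : CurveAssumptions Γ a) (s : ℝ) (i : Fin 2) :
    HasDerivAt (fun s => deriv Γ s i) (iteratedDeriv 2 Γ s i) s := by
  rw [iteratedDeriv_succ, iteratedDeriv_one]
  exact (EuclideanSpace.proj i : Plane →L[ℝ] ℝ).hasFDerivAt.comp_hasDerivAt s
    (hΓ.contDiff_deriv.differentiable (by norm_num) s).hasDerivAt

theorem CurveAssumptions.hasFDerivAt_stripProd (hΓ : CurveAssumptions Γ a) (p : ℝ × ℝ) :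
    HasFDerivAt (stripProd Γ) (stripDeriv Γ p) p := by
  have h (i : Fin 2) := (hΓ.hasDerivAt p.1 i).hasFDerivAt.comp p hasFDerivAt_fst
  have h' (i : Fin 2) := (hΓ.hasDerivAt_deriv p.1 i).hasFDerivAt.comp p hasFDerivAt_fst
  have h2 : HasFDerivAt (fun p : ℝ × ℝ => p.2) (ContinuousLinearMap.snd ℝ ℝ ℝ) p := hasFDerivAt_snd
  refine ((((h 0).sub (h2.mul (h' 1))).prodMk ((h 1).add (h2.mul (h' 0))))).congr_fderiv ?_
  rw [stripDeriv, Matrix.toLin_finTwoProd_toContinuousLinearMap]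
  ext <;> simp

theorem CurveAssumptions.continuous_curvature (hΓ : CurveAssumptions Γ a) :
    Continuous (curvature Γ) := by
  have h1 : Continuous (deriv Γ) := hΓ.contDiff_deriv.continuous
  have h2 : Continuous (iteratedDeriv 2 Γ) := hΓ.contDiff.continuous_iteratedDeriv' 2
  unfold curvature
  fun_prop

/-- For each `s` at most one `u` satisfies `1 + u γ(s) = 0`; Fubini does the rest. -/
theorem CurveAssumptions.ae_det_ne_zero (hΓ : CurveAssumptions Γ a) :
    ∀ᵐ p : ℝ × ℝ, (stripDeriv Γ p).det ≠ 0 := by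
  simp only [hΓ.det_stripDeriv]
  have hc := hΓ.continuous_curvature
  have hm : MeasurableSet {p : ℝ × ℝ | 1 + p.2 * curvature Γ p.1 = 0} :=
    (isClosed_eq (by fun_prop) continuous_const).measurableSet
  rw [ae_iff]
  simp only [ne_eq, not_not]
  rw [Measure.volume_eq_prod, Measure.measure_prod_null hm]
  refine Eventually.of_forall fun s => ?_
  refine Set.Subsingleton.measure_zero (fun u hu v hv => ?_) _
  simp only [Set.mem_preimage, Set.mem_ofPred_eq] at hu hv
  have hne : curvature Γ s ≠ 0 := by
    intro h
    rw [h] at hu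
    simp at hu
  exact mul_right_cancel₀ hne (by linarith)

theorem CurveAssumptions.injOn_stripProd (hΓ : CurveAssumptions Γ a) :
    Set.InjOn (stripProd Γ) (Set.univ ×ˢ Set.Ioo (-a) a) := fun p hp q hq h =>
  hΓ.stripMap_injOn hp hq (by rw [← planeEquiv_stripProd, h, planeEquiv_stripProd])

theorem CurveAssumptions.continuous_stripMap (hΓ : CurveAssumptions Γ a) :
    Continuous (stripMap Γ) := by
  have h1 : Continuous (deriv Γ) := hΓ.contDiff_deriv.continuous
  have h2 : Continuous Γ := hΓ.contDiff.continuous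
  unfold stripMap
  fun_prop

theorem ae_snd {P : ℝ → Prop} (h : ∀ᵐ u, P u) : ∀ᵐ p : ℝ × ℝ, P p.2 :=
  Measure.quasiMeasurePreserving_snd.ae h

theorem ae_of_ae_snd {P : ℝ → Prop} (h : ∀ᵐ p : ℝ × ℝ, P p.2) : ∀ᵐ u, P u := by
  have h1 : {p : ℝ × ℝ | ¬ P p.2} = Set.univ ×ˢ {u | ¬ P u} := by
    ext p
    simp
  rw [ae_iff, h1, Measure.volume_eq_prod, Measure.prod_prod, Real.volume_univ] at h
  exact (mul_eq_zero.mp h).resolve_left (by simp)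

/-- An almost sure property of the transverse coordinate holds almost everywhere in the strip. -/
theorem CurveAssumptions.ae_forall_stripMap (hΓ : CurveAssumptions Γ a) {P : ℝ → Prop}
    (h : ∀ᵐ u, P u) : ∀ᵐ x : Plane, ∀ p : ℝ × ℝ, stripMap Γ p = x → P p.2 := by
  have h1 : ∀ᵐ y : ℝ × ℝ, ∀ p : ℝ × ℝ, stripProd Γ p = y → P p.2 := by
    -- Differentiable maps send null sets to null sets.
    have h2 := addHaar_image_eq_zero_of_differentiableOn_of_addHaar_eq_zero volume
      (f := stripProd Γ)
      (fun p _ => (hΓ.hasFDerivAt_stripProd p).differentiableAt.differentiableWithinAt)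
      (ae_iff.mp (ae_snd h))
    rw [ae_iff]
    refine measure_mono_null (fun y hy => ?_) h2
    simp only [Set.mem_ofPred_eq, not_forall] at hy
    obtain ⟨p, rfl, hp⟩ := hy
    exact ⟨p, hp, rfl⟩
  filter_upwards [measurePreserving_planeEquiv.symm.quasiMeasurePreserving.ae h1] with x hx p hp
  refine hx p ?_
  rw [← hp, ← planeEquiv_stripProd, MeasurableEquiv.symm_apply_apply]

/-- A property that holds almost everywhere in the strip and depends only on the transverse
coordinate holds for almost every value of this coordinate. -/
theorem CurveAssumptions.ae_of_ae_stripMap (hΓ : CurveAssumptions Γ a) {P : ℝ → Prop}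
    (h : ∀ᵐ x : Plane, ∀ p : ℝ × ℝ, p.2 ∈ Set.Ioo (-a) a → stripMap Γ p = x → P p.2) :
    ∀ᵐ u, u ∈ Set.Ioo (-a) a → P u := by
  have h1 : ∀ᵐ y : ℝ × ℝ, ∀ p : ℝ × ℝ, p.2 ∈ Set.Ioo (-a) a → stripProd Γ p = y → P p.2 := by
    filter_upwards [measurePreserving_planeEquiv.quasiMeasurePreserving.ae h] with y hy p hp hpy
    exact hy p hp (by rw [← planeEquiv_stripProd, hpy])
  obtain ⟨N, hN, hNm, hN0⟩ := exists_measurable_superset_of_null (ae_iff.mp h1)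
  have hcont : Continuous (stripProd Γ) :=
    continuous_iff_continuousAt.mpr fun p => (hΓ.hasFDerivAt_stripProd p).continuousAt
  set S : Set (ℝ × ℝ) := stripProd Γ ⁻¹' N ∩ Set.univ ×ˢ Set.Ioo (-a) a with hS
  have hSm : MeasurableSet S :=
    (hcont.measurable hNm).inter (MeasurableSet.univ.prod measurableSet_Ioo)
  -- Change of variables: `S` has a null image, so the Jacobian integrates to zero over `S`; being
  -- a.e. nonzero, it forces `S` to be null.
  have h2 := lintegral_abs_det_fderiv_eq_addHaar_image volume hSm
    (fun p _ => (hΓ.hasFDerivAt_stripProd p).hasFDerivWithinAt)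
    (hΓ.injOn_stripProd.mono Set.inter_subset_right)
  have h3 : volume (stripProd Γ '' S) = 0 := by
    refine measure_mono_null ?_ hN0
    rintro _ ⟨p, hp, rfl⟩
    exact hp.1
  have hc := hΓ.continuous_curvature
  have hdet : Measurable fun p => ENNReal.ofReal |(stripDeriv Γ p).det| := by
    simp only [hΓ.det_stripDeriv]
    exact ENNReal.measurable_ofReal.comp (Continuous.measurable (by fun_prop))
  rw [h3, lintegral_eq_zero_iff hdet, EventuallyEq, ae_restrict_iff' hSm] at h2
  refine ae_of_ae_snd ?_
  filter_upwards [h2, hΓ.ae_det_ne_zero] with p h4 h5 hp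
  have h6 : p ∉ S := fun hpS => h5 (by simpa using h4 hpS)
  have h7 : stripProd Γ p ∉ N := fun h => h6 ⟨h, trivial, hp⟩
  by_contra hP
  exact h7 (hN fun h => hP (h p hp rfl))

/-! ### The potential -/

theorem CurveAssumptions.injective_stripMap (hΓ : CurveAssumptions Γ a) :
    Function.Injective (fun p : ℝ × Set.Ioo (-a) a => stripMap Γ (p.1, (p.2 : ℝ))) := by
  intro p q h
  have := hΓ.stripMap_injOn (x₁ := (p.1, (p.2 : ℝ))) (x₂ := (q.1, (q.2 : ℝ)))
    ⟨trivial, p.2.2⟩ ⟨trivial, q.2.2⟩ h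
  rw [Prod.mk.injEq] at this
  exact Prod.ext this.1 (Subtype.ext this.2)

theorem CurveAssumptions.potential_stripMap (hΓ : CurveAssumptions Γ a) {p : ℝ × ℝ}
    (hp : p.2 ∈ Set.Ioo (-a) a) : potential Γ a V (stripMap Γ p) = V p.2 :=
  hΓ.injective_stripMap.extend_apply _ _ (p.1, ⟨p.2, hp⟩)

theorem potential_eq_zero {x : Plane} (h : ∀ p : ℝ × ℝ, p.2 ∈ Set.Ioo (-a) a → stripMap Γ p ≠ x) :
    potential Γ a V x = 0 :=
  Function.extend_apply' _ _ _ fun ⟨p, hp⟩ => h (p.1, p.2) p.2.2 hp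

/-- A property of the values of `V` that holds almost surely, and for the value zero, holds for the
values of the potential. -/
theorem CurveAssumptions.ae_potential (hΓ : CurveAssumptions Γ a) {P : ℝ → Prop}
    (h : ∀ᵐ u, P (V u)) (h0 : P 0) : ∀ᵐ x, P (potential Γ a V x) := by
  filter_upwards [hΓ.ae_forall_stripMap h] with x hx
  by_cases hp : ∃ p : ℝ × ℝ, p.2 ∈ Set.Ioo (-a) a ∧ stripMap Γ p = x
  · obtain ⟨p, hp, rfl⟩ := hp
    rw [hΓ.potential_stripMap hp]
    exact hx p rfl
  · rw [potential_eq_zero fun p h1 h2 => hp ⟨p, h1, h2⟩]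
    exact h0

/-- An injective continuous map between standard Borel spaces is a measurable embedding
(Lusin–Souslin), so a Borel representative of `V` extends by zero to a Borel function. -/
theorem CurveAssumptions.aestronglyMeasurable_potential (hΓ : CurveAssumptions Γ a)
    (hV : AEStronglyMeasurable V) : AEStronglyMeasurable (potential Γ a V) := by
  have hemb : MeasurableEmbedding
      (fun p : ℝ × Set.Ioo (-a) a => stripMap Γ (p.1, (p.2 : ℝ))) := by
    have : StandardBorelSpace (Set.Ioo (-a) a) := measurableSet_Ioo.standardBorel
    have hc := hΓ.continuous_stripMap
    refine Measurable.measurableEmbedding (Continuous.measurable ?_) hΓ.injective_stripMap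
    fun_prop
  have hm : Measurable (potential Γ a (hV.mk V)) :=
    hemb.measurable_extend (hV.stronglyMeasurable_mk.measurable.comp
      (measurable_subtype_coe.comp measurable_snd)) measurable_const
  refine ⟨_, hm.stronglyMeasurable, ?_⟩
  filter_upwards [hΓ.ae_forall_stripMap hV.ae_eq_mk] with x hx
  by_cases hp : ∃ p : ℝ × ℝ, p.2 ∈ Set.Ioo (-a) a ∧ stripMap Γ p = x
  · obtain ⟨p, hp, rfl⟩ := hp
    rw [hΓ.potential_stripMap hp, hΓ.potential_stripMap hp]
    exact hx p rfl
  · rw [potential_eq_zero fun p h1 h2 => hp ⟨p, h1, h2⟩,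
      potential_eq_zero fun p h1 h2 => hp ⟨p, h1, h2⟩]

theorem CurveAssumptions.stripMap_mem_strip (hΓ : CurveAssumptions Γ a) {p : ℝ × ℝ}
    (hp : p.2 ∈ Set.Ioo (-a) a) : stripMap Γ p ∈ strip Γ a := by
  refine Metric.mem_thickening_iff.mpr ⟨Γ p.1, ⟨p.1, rfl⟩, ?_⟩
  have h1 := EuclideanSpace.real_norm_sq_eq (deriv Γ p.1)
  rw [hΓ.unitSpeed, Fin.sum_univ_two] at h1
  have h2 : dist (stripMap Γ p) (Γ p.1) = |p.2| := by
    rw [EuclideanSpace.dist_eq, Fin.sum_univ_two, ← Real.sqrt_sq_eq_abs]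
    congr 1
    simp only [stripMap, Real.dist_eq, sq_abs]
    simp
    linear_combination (-p.2 ^ 2) * h1
  rw [h2, abs_lt]
  exact hp

theorem CurveAssumptions.potential_eq_zero_of_notMem (hΓ : CurveAssumptions Γ a) {x : Plane}
    (hx : x ∉ strip Γ a) : potential Γ a V x = 0 :=
  potential_eq_zero fun _ hp h => hx (h ▸ hΓ.stripMap_mem_strip hp)

theorem potential_ae_ne_zero (hΓ : CurveAssumptions Γ a) (hV : ProfileAssumptions V a) :
    ¬ potential Γ a V =ᵐ[volume] 0 := by
  intro h
  refine hV.ne_zero ?_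
  have h1 := hΓ.ae_of_ae_stripMap (P := fun u => V u = 0) (by
    filter_upwards [h] with x hx p hp hpx
    rw [← hΓ.potential_stripMap (V := V) hp, hpx]
    exact hx)
  -- The profile lives on the closed interval, the strip coordinates on the open one; the endpoints
  -- are null.
  have h2 : ∀ᵐ u : ℝ, u ≠ -a := by simp [ae_iff]
  have h3 : ∀ᵐ u : ℝ, u ≠ a := by simp [ae_iff]
  filter_upwards [h1, h2, h3, hV.support] with u h1 h2 h3 h4
  by_cases hu : u ∈ Set.Icc (-a) a
  · exact h1 ⟨lt_of_le_of_ne hu.1 (Ne.symm h2), lt_of_le_of_ne hu.2 h3⟩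
  · exact h4 hu

end Strip

/-! ### The factorization of the Birman-Schwinger operator -/

section Factorization

variable {Γ : ℝ → Plane} {a : ℝ} {V : ℝ → ℝ}

theorem measurableSet_strip : MeasurableSet (strip Γ a) := Metric.isOpen_thickening.measurableSet

theorem abs_potential_le (hΓ : CurveAssumptions Γ a) (hV : ProfileAssumptions V a) :
    ∀ᵐ x, |potential Γ a V x| ≤ (eLpNorm V ∞ volume).toReal := by
  refine hΓ.ae_potential (P := fun v => |v| ≤ (eLpNorm V ∞ volume).toReal) ?_ (by simp)
  rw [eLpNorm_exponent_top]
  filter_upwards [ae_le_eLpNormEssSup (f := V) (μ := volume)] with u hu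
  have h1 : eLpNormEssSup V volume ≠ ∞ := by
    rw [← eLpNorm_exponent_top]
    exact hV.memLp.2.ne
  have := ENNReal.toReal_mono h1 hu
  simpa using this

theorem memLp_potential (hΓ : CurveAssumptions Γ a) (hV : ProfileAssumptions V a) :
    MemLp (potential Γ a V) ∞ volume :=
  memLp_top_of_bound (hΓ.aestronglyMeasurable_potential hV.memLp.1) _ (abs_potential_le hΓ hV)

theorem memLp_sqrt_potential (hΓ : CurveAssumptions Γ a) (hV : ProfileAssumptions V a) :
    MemLp (fun x => √(potential Γ a V x)) ∞ volume := by
  refine memLp_top_of_bound (Real.continuous_sqrt.comp_aestronglyMeasurable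
    (memLp_potential hΓ hV).1) (√(eLpNorm V ∞ volume).toReal) ?_
  filter_upwards [abs_potential_le hΓ hV] with x hx
  rw [Real.norm_eq_abs, abs_of_nonneg (Real.sqrt_nonneg _)]
  exact Real.sqrt_le_sqrt ((le_abs_self _).trans hx)

theorem inner_restrictStrip (ψ : L2Strip Γ a) (g : L2Plane) :
    inner ℂ ψ (restrictStrip Γ a g) = ∫ x in strip Γ a, inner ℂ (ψ x) (g x) := by
  rw [L2.inner_def]
  refine integral_congr_ae ?_
  filter_upwards [LpToLpRestrictCLM_coeFn ℂ (strip Γ a) g] with x hx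
  rw [restrictStrip, hx]

/-- The adjoint of the restriction to the strip is the extension by zero. -/
theorem restrictStrip_adjoint_coeFn (ψ : L2Strip Γ a) :
    (restrictStrip Γ a).adjoint ψ =ᵐ[volume] (strip Γ a).indicator ψ := by
  have hm : MemLp ((strip Γ a).indicator ψ) 2 volume :=
    (memLp_indicator_iff_restrict measurableSet_strip).mpr (Lp.memLp ψ)
  have h : (restrictStrip Γ a).adjoint ψ = hm.toLp _ := by
    refine ext_inner_right ℂ fun g => ?_
    rw [ContinuousLinearMap.adjoint_inner_left, inner_restrictStrip, L2.inner_def,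
      ← integral_indicator measurableSet_strip]
    refine integral_congr_ae ?_
    filter_upwards [hm.coeFn_toLp] with x hx
    rw [hx]
    by_cases hxs : x ∈ strip Γ a <;> simp [hxs]
  rw [h]
  exact hm.coeFn_toLp

/-- The operator `Ṽ^{1/2} : L²(ℝ²) → L²(Ω^a)`. -/
noncomputable def sqrtPotentialOp (Γ : ℝ → Plane) (a : ℝ) (V : ℝ → ℝ) : L2Plane →L[ℂ] L2Strip Γ a :=
  restrictStrip Γ a ∘L mulOp (fun x => √(potential Γ a V x))

theorem adjoint_sqrtPotentialOp (hΓ : CurveAssumptions Γ a) (hV : ProfileAssumptions V a) :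
    (sqrtPotentialOp Γ a V).adjoint =
      mulOp (fun x => √(potential Γ a V x)) ∘L (restrictStrip Γ a).adjoint := by
  have h : (mulOp (fun x => √(potential Γ a V x))).adjoint =
      mulOp (fun x => √(potential Γ a V x)) :=
    ((ContinuousLinearMap.eq_adjoint_iff _ _).mpr
      (inner_mulOp_comm (memLp_sqrt_potential hΓ hV))).symm
  rw [sqrtPotentialOp, ContinuousLinearMap.adjoint_comp, h]

theorem adjoint_sqrtPotentialOp_coeFn (hΓ : CurveAssumptions Γ a) (hV : ProfileAssumptions V a)
    (ψ : L2Strip Γ a) : (sqrtPotentialOp Γ a V).adjoint ψ =ᵐ[volume]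
      fun x => ((√(potential Γ a V x) : ℝ) : ℂ) * (strip Γ a).indicator ψ x := by
  rw [adjoint_sqrtPotentialOp hΓ hV]
  filter_upwards [mulOp_coeFn (memLp_sqrt_potential hΓ hV) ((restrictStrip Γ a).adjoint ψ),
    restrictStrip_adjoint_coeFn ψ] with x h1 h2
  rw [ContinuousLinearMap.comp_apply, h1, h2]

/-- Passing through `L²(Ω^a)` loses nothing because the potential vanishes off the strip; a.e.
nonnegativity gives `√Ṽ · √Ṽ = Ṽ`. -/
theorem adjoint_comp_sqrtPotentialOp (hΓ : CurveAssumptions Γ a) (hV : ProfileAssumptions V a) :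
    (sqrtPotentialOp Γ a V).adjoint ∘L sqrtPotentialOp Γ a V = mulOp (potential Γ a V) := by
  ext1 f
  refine Lp.ext ?_
  have h1 : ∀ᵐ x, 0 ≤ potential Γ a V x := hΓ.ae_potential hV.nonneg le_rfl
  have h2 := (ae_restrict_iff' measurableSet_strip).mp
    (LpToLpRestrictCLM_coeFn ℂ (strip Γ a) (mulOp (fun x => √(potential Γ a V x)) f))
  filter_upwards [adjoint_sqrtPotentialOp_coeFn hΓ hV (sqrtPotentialOp Γ a V f), h1, h2,
    mulOp_coeFn (memLp_sqrt_potential hΓ hV) f, mulOp_coeFn (memLp_potential hΓ hV) f]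
    with x h3 h4 h5 h6 h7
  rw [ContinuousLinearMap.comp_apply, h3, h7]
  by_cases hx : x ∈ strip Γ a
  · rw [Set.indicator_of_mem hx, sqrtPotentialOp, ContinuousLinearMap.comp_apply, restrictStrip,
      h5 hx, h6, ← mul_assoc, ← Complex.ofReal_mul, Real.mul_self_sqrt h4]
  · rw [Set.indicator_of_notMem hx, hΓ.potential_eq_zero_of_notMem hx]
    simp

theorem hamiltonian_eq (hΓ : CurveAssumptions Γ a) (hV : ProfileAssumptions V a) :
    hamiltonian Γ a V = subBounded negLaplacian
      ((sqrtPotentialOp Γ a V).adjoint ∘L sqrtPotentialOp Γ a V) := by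
  rw [adjoint_comp_sqrtPotentialOp hΓ hV]
  rfl

theorem birmanSchwinger_eq (hΓ : CurveAssumptions Γ a) (hV : ProfileAssumptions V a) (z : ℂ) :
    birmanSchwinger Γ a V z =
      sqrtPotentialOp Γ a V ∘L resolvent negLaplacian z ∘L (sqrtPotentialOp Γ a V).adjoint := by
  rw [adjoint_sqrtPotentialOp hΓ hV]
  rfl

/-- The C*-identity `‖B‖² = ‖B†B‖` reduces this to multiplication by `Ṽ`. -/
theorem norm_sqrtPotentialOp_mul_self_le (hΓ : CurveAssumptions Γ a)
    (hV : ProfileAssumptions V a) :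
    ‖sqrtPotentialOp Γ a V‖ * ‖sqrtPotentialOp Γ a V‖ ≤ (eLpNorm V ∞ volume).toReal := by
  rw [← ContinuousLinearMap.norm_adjoint_comp_self, adjoint_comp_sqrtPotentialOp hΓ hV]
  exact norm_mulOp_le ENNReal.toReal_nonneg (memLp_potential hΓ hV) (abs_potential_le hΓ hV)

/-- Constants are not in `L²(ℝ²)`, so the operator is tested on indicators of balls exhausting the
plane. -/
theorem mulOp_ne_zero {m : Plane → ℝ} (hm : MemLp m ∞ volume) (h : ¬ m =ᵐ[volume] 0) :
    mulOp m ≠ 0 := by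
  intro h0
  refine h ?_
  have h1 (n : ℕ) : ∀ᵐ x, x ∈ Metric.ball (0 : Plane) n → m x = 0 := by
    have h2 := mulOp_coeFn hm
      (indicatorConstLp 2 (Metric.isOpen_ball (x := (0 : Plane)) (ε := n)).measurableSet
        measure_ball_lt_top.ne (1 : ℂ))
    rw [h0, _root_.zero_apply] at h2
    filter_upwards [h2, Lp.coeFn_zero ℂ 2 (volume : Measure Plane),
      indicatorConstLp_coeFn (p := 2)
        (hs := (Metric.isOpen_ball (x := (0 : Plane)) (ε := n)).measurableSet)
        (hμs := measure_ball_lt_top.ne) (c := (1 : ℂ))] with x h3 h4 h5 hx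
    rw [h4, h5, Set.indicator_of_mem hx] at h3
    simpa using h3.symm
  filter_upwards [ae_all_iff.mpr h1] with x hx
  obtain ⟨n, hn⟩ := exists_nat_gt ‖x‖
  exact hx n (by simpa using hn)

theorem exists_adjoint_sqrtPotentialOp_ne_zero (hΓ : CurveAssumptions Γ a)
    (hV : ProfileAssumptions V a) : ∃ ψ, (sqrtPotentialOp Γ a V).adjoint ψ ≠ 0 := by
  by_contra! h
  refine mulOp_ne_zero (memLp_potential hΓ hV) (potential_ae_ne_zero hΓ hV) ?_
  rw [← adjoint_comp_sqrtPotentialOp hΓ hV]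
  ext1 f
  exact h _

theorem isResolventAt_negLaplacian {z : ℂ} (hz : ¬ ∃ t : ℝ, 0 ≤ t ∧ z = (t : ℂ)) :
    IsResolventAt negLaplacian z (resolvent negLaplacian z) :=
  isResolventAt_resolvent
    (isSelfAdjointPMap_negLaplacian.mem_resolventSet_of_nonneg negLaplacian_nonneg hz)

theorem isResolventAt_negLaplacian_neg_sq {κ : ℝ} (hκ : 0 < κ) :
    IsResolventAt negLaplacian (-(κ : ℂ) ^ 2) (resolvent negLaplacian (-(κ : ℂ) ^ 2)) := by
  refine isResolventAt_negLaplacian ?_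
  rintro ⟨t, ht, h⟩
  have h1 : -κ ^ 2 = t := by exact_mod_cast h
  nlinarith [pow_pos hκ 2]

theorem re_inner_birmanSchwinger_lt (hΓ : CurveAssumptions Γ a) (hV : ProfileAssumptions V a)
    {ψ : L2Strip Γ a} (hψ : (sqrtPotentialOp Γ a V).adjoint ψ ≠ 0) {κ₁ κ₂ : ℝ} (hκ₁ : 0 < κ₁)
    (hκ : κ₁ < κ₂) : (inner ℂ ψ (birmanSchwinger Γ a V (-(κ₂ : ℂ) ^ 2) ψ)).re <
      (inner ℂ ψ (birmanSchwinger Γ a V (-(κ₁ : ℂ) ^ 2) ψ)).re := by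
  rw [birmanSchwinger_eq hΓ hV, birmanSchwinger_eq hΓ hV]
  simp only [ContinuousLinearMap.comp_apply]
  rw [← ContinuousLinearMap.adjoint_inner_left (sqrtPotentialOp Γ a V),
    ← ContinuousLinearMap.adjoint_inner_left (sqrtPotentialOp Γ a V)]
  exact (isResolventAt_negLaplacian_neg_sq hκ₁).re_inner_lt isSelfAdjointPMap_negLaplacian
    negLaplacian_nonneg hκ₁ hκ (isResolventAt_negLaplacian_neg_sq (hκ₁.trans hκ)) hψ

theorem norm_birmanSchwinger_le (hΓ : CurveAssumptions Γ a) (hV : ProfileAssumptions V a) {κ : ℝ}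
    (hκ : 0 < κ) : ‖birmanSchwinger Γ a V (-(κ : ℂ) ^ 2)‖ ≤
      (κ ^ 2)⁻¹ * (eLpNorm V ∞ volume).toReal := by
  set B := sqrtPotentialOp Γ a V with hB
  set R := resolvent negLaplacian (-(κ : ℂ) ^ 2)
  have hR : ‖R‖ ≤ (κ ^ 2)⁻¹ :=
    (isResolventAt_negLaplacian_neg_sq hκ).norm_le negLaplacian_nonneg hκ
  have hBadj : ‖B.adjoint‖ = ‖B‖ := LinearIsometryEquiv.norm_map _ B
  rw [birmanSchwinger_eq hΓ hV]
  calc ‖B ∘L R ∘L B.adjoint‖ ≤ ‖B‖ * (‖R‖ * ‖B.adjoint‖) :=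
        (ContinuousLinearMap.opNorm_comp_le _ _).trans
          (mul_le_mul_of_nonneg_left (ContinuousLinearMap.opNorm_comp_le _ _) (norm_nonneg _))
    _ = ‖R‖ * (‖B‖ * ‖B‖) := by rw [hBadj]; ring
    _ ≤ (κ ^ 2)⁻¹ * (eLpNorm V ∞ volume).toReal :=
        mul_le_mul hR (norm_sqrtPotentialOp_mul_self_le hΓ hV) (by positivity) (by positivity)

end Factorization

end SoftWaveguide

/-! ### The main theorem -/

theorem mainTheorem6 (Γ : ℝ → SoftWaveguide.Plane) (a : ℝ) (V : ℝ → ℝ)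
    (hΓ : SoftWaveguide.CurveAssumptions Γ a) (hV : SoftWaveguide.ProfileAssumptions V a) :
    -- the Birman-Schwinger principle, for `z ∈ ℂ \ [0, ∞)`
    (∀ z : ℂ, (¬ ∃ t : ℝ, 0 ≤ t ∧ z = (t : ℂ)) →
      (z ∈ SoftWaveguide.discreteSpectrum (SoftWaveguide.hamiltonian Γ a V) ↔
        (1 : ℂ) ∈ SoftWaveguide.discreteSpectrum
          (SoftWaveguide.ofBounded (SoftWaveguide.birmanSchwinger Γ a V z)))) ∧
    -- norm continuity
    ContinuousOn (fun κ : ℝ => SoftWaveguide.birmanSchwinger Γ a V (-(κ : ℂ) ^ 2)) (Set.Ioi 0) ∧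
    -- monotonicity in the operator order
    StrictAntiOn (fun κ : ℝ => SoftWaveguide.birmanSchwinger Γ a V (-(κ : ℂ) ^ 2)) (Set.Ioi 0) ∧
    -- strict monotonicity of the quadratic forms
    (∀ ψ : SoftWaveguide.L2Strip Γ a,
      (¬ (fun x => ((√(SoftWaveguide.potential Γ a V x) : ℝ) : ℂ) * ψ x)
        =ᵐ[volume.restrict (SoftWaveguide.strip Γ a)] 0) →
      StrictAntiOn (fun κ : ℝ =>
        (inner ℂ ψ (SoftWaveguide.birmanSchwinger Γ a V (-(κ : ℂ) ^ 2) ψ)).re) (Set.Ioi 0)) ∧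
    -- norm bound and decay
    (∀ κ : ℝ, 0 < κ → ‖SoftWaveguide.birmanSchwinger Γ a V (-(κ : ℂ) ^ 2)‖ ≤
      (κ ^ 2)⁻¹ * (eLpNorm V ∞ volume).toReal) ∧
    Tendsto (fun κ : ℝ => ‖SoftWaveguide.birmanSchwinger Γ a V (-(κ : ℂ) ^ 2)‖) atTop (𝓝 0) := by
  refine ⟨fun z hz => ?_, ?_, ?_, fun ψ hψ κ₁ hκ₁ κ₂ _ hκ => ?_,
    fun κ hκ => SoftWaveguide.norm_birmanSchwinger_le hΓ hV hκ, ?_⟩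
  · rw [SoftWaveguide.hamiltonian_eq hΓ hV, SoftWaveguide.birmanSchwinger_eq hΓ hV]
    exact (SoftWaveguide.isResolventAt_negLaplacian hz).mem_discreteSpectrum_iff
      SoftWaveguide.isSelfAdjointPMap_negLaplacian
  · simp only [SoftWaveguide.birmanSchwinger_eq hΓ hV]
    have h := SoftWaveguide.continuousOn_of_isResolventAt SoftWaveguide.negLaplacian_nonneg
      (R := fun κ : ℝ => SoftWaveguide.resolvent SoftWaveguide.negLaplacian (-(κ : ℂ) ^ 2))
      fun κ hκ => SoftWaveguide.isResolventAt_negLaplacian_neg_sq hκ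
    exact continuousOn_const.clm_comp (h.clm_comp continuousOn_const)
  · intro κ₁ hκ₁ κ₂ hκ₂ hκ
    refine lt_of_le_of_ne ?_ fun h => ?_
    · rw [ContinuousLinearMap.le_def]
      simp only [SoftWaveguide.birmanSchwinger_eq hΓ hV]
      rw [← ContinuousLinearMap.comp_sub, ← ContinuousLinearMap.sub_comp]
      exact ((SoftWaveguide.isResolventAt_negLaplacian_neg_sq hκ₁).isPositive_sub
        SoftWaveguide.isSelfAdjointPMap_negLaplacian SoftWaveguide.negLaplacian_nonneg hκ₁ hκ
        (SoftWaveguide.isResolventAt_negLaplacian_neg_sq hκ₂)).conj_adjoint _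
    -- Equality of the operators would contradict the strict form inequality at a single `ψ` with
    -- `B†ψ ≠ 0`.
    · obtain ⟨ψ, hψ⟩ := SoftWaveguide.exists_adjoint_sqrtPotentialOp_ne_zero hΓ hV
      have h1 := SoftWaveguide.re_inner_birmanSchwinger_lt hΓ hV hψ hκ₁ hκ
      simp only at h
      rw [h] at h1
      exact lt_irrefl _ h1
  -- `B†ψ` is `Ṽ^{1/2} ψ` extended by zero, so its vanishing would contradict the hypothesis on `ψ`.
  · refine SoftWaveguide.re_inner_birmanSchwinger_lt hΓ hV (fun h => hψ ?_) hκ₁ hκ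
    have h1 := SoftWaveguide.adjoint_sqrtPotentialOp_coeFn hΓ hV ψ
    rw [h] at h1
    rw [EventuallyEq, ae_restrict_iff' SoftWaveguide.measurableSet_strip]
    filter_upwards [h1, Lp.coeFn_zero ℂ 2 (volume : Measure SoftWaveguide.Plane)] with x h2 h3 hx
    rw [h3, Set.indicator_of_mem hx] at h2
    exact h2.symm
  · have hlim : Tendsto (fun κ : ℝ => (κ ^ 2)⁻¹ * (eLpNorm V ∞ volume).toReal) atTop (𝓝 0) := by
      have h := (tendsto_inv_atTop_zero.comp (tendsto_pow_atTop (α := ℝ) two_ne_zero)).mul_const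
        (eLpNorm V ∞ volume).toReal
      rwa [zero_mul] at h
    refine squeeze_zero' (Eventually.of_forall fun _ => norm_nonneg _) ?_ hlim
    filter_upwards [eventually_gt_atTop 0] with κ hκ
    exact SoftWaveguide.norm_birmanSchwinger_le hΓ hV hκ
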